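/- Let $i\ge 2$ be an integer. The $i$-Fibonacci words over $\{0,1\}$ are given by $f_1^{[i]}=0$, $f_2^{[i]}=0^{i-1}1$ and $f_n^{[i]}=f_{n-1}^{[i]}f_{n-2}^{[i]}$ (concatenation) for $n\ge 3$. For an angle $\alpha$, the curve $\mathcal F_n^{[i]}\subset\mathbb R^2$ is drawn from $f_n^{[i]}=a_1a_2\cdots a_m$ as follows: start at the origin with direction $\pi/2$; for $j=1,\dots,m$ draw a segment of length one in the current direction and then, if $a_j=0$, add $\alpha$ to the direction when $j$ is even and subtract $\alpha$ from it when $j$ is odd, while if $a_j=1$ the direction is kept. Let $w_n^{[i]}(\alpha)$ be the distance between the first and the last vertex of $\mathcal F_n^{[i]}$. Put $n_k=6k+5$ if $i$ is even and $n_k=6k+3$ if $i$ is odd. For $\alpha\in(0,\pi/2]$ let $\mathcal F_\alpha^{[i]}$ be the limit as $k\to\infty$, in the Hausdorff metric on nonempty compact subsets of $\mathbb R^2$, of the scaled curves $\frac{\sqrt 2}{w_{n_k}^{[i]}(\alpha)}\,\mathcal F_{n_k}^{[i]}$. Then this limit exists for every $\alpha\in(0,\pi/2]$, and $$\lim_{\alpha\to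 0^+}\dim_{\mathcal H}\mathcal F_\alpha^{[i]}=1,$$ where $\dim_{\mathcal H}$ denotes the Hausdorff dimension. -/

import Mathlib

open Filter Topology

noncomputable section

/-- The `i`-Fibonacci words over `{0, 1}`: `f 1 = 0`, `f 2 = 0^(i-1) 1` and
`f n = f (n-1) f (n-2)` (concatenation) for `n ≥ 3`. The words are indexed from `1`;
the value at `0` is never used. -/
def fibWord (i : ℕ) : ℕ → List (Fin 2)
  | 0 => []
  | 1 => [0]
  | 2 => List.replicate (i - 1) 0 ++ [1]
  | n + 3 => fibWord i (n + 2) ++ fibWord i (n + 1)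

/-- The change of direction, in units of the drawing angle, caused by the letter `b` in position
`j` (positions are counted from `1`): for `b = 0` turn left if `j` is even and right if `j` is odd;
for `b = 1` keep the direction. -/
def turn (j : ℕ) (b : Fin 2) : ℝ :=
  if b = 0 then (if Even j then 1 else -1) else 0

/-- The direction reached after reading the whole word `w`, with initial direction `π / 2`. -/
def heading (α : ℝ) (w : List (Fin 2)) : ℝ :=
  Real.pi / 2 + α * ∑ j ∈ Finset.range w.length, turn (j + 1) (w.getD j 1)

/-- The `k`-th vertex (`0 ≤ k ≤ w.length`) of the curve drawn from the word `w`: it starts at the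
origin, and its `(j+1)`-th segment has length one and the direction that has been reached after
reading the first `j` letters. -/
def curveVertex (α : ℝ) (w : List (Fin 2)) (k : ℕ) : EuclideanSpace ℝ (Fin 2) :=
  ∑ j ∈ Finset.range k, !₂[Real.cos (heading α (w.take j)), Real.sin (heading α (w.take j))]

/-- The curve drawn from the word `w` with drawing angle `α`, as a subset of the plane: one unit
segment for each letter of `w` (together with the starting point, which matters for the empty word
only). -/
def wordCurve (α : ℝ) (w : List (Fin 2)) : Set (EuclideanSpace ℝ (Fin 2)) :=
  {0} ∪ ⋃ k ∈ Finset.range w.length, segment ℝ (curveVertex α w k) (curveVertex α w (k + 1))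

theorem wordCurve_nonempty (α : ℝ) (w : List (Fin 2)) : (wordCurve α w).Nonempty :=
  ⟨0, Or.inl rfl⟩

theorem wordCurve_isCompact (α : ℝ) (w : List (Fin 2)) : IsCompact (wordCurve α w) := by
  refine isCompact_singleton.union ((Finset.range w.length).isCompact_biUnion fun k _ => ?_)
  rw [segment_eq_image]
  exact isCompact_Icc.image (by fun_prop)

/-- The curve of `w` as an element of the Hausdorff metric space of nonempty compact subsets of
the plane. -/
def wordCurveCompact (α : ℝ) (w : List (Fin 2)) :
    TopologicalSpace.NonemptyCompacts (EuclideanSpace ℝ (Fin 2)) where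
  carrier := wordCurve α w
  isCompact' := wordCurve_isCompact α w
  nonempty' := wordCurve_nonempty α w

/-- The width of the `n`-th `i`-Fibonacci curve: the distance between its first and last vertex. -/
def fibWidth (i : ℕ) (α : ℝ) (n : ℕ) : ℝ :=
  dist (curveVertex α (fibWord i n) 0) (curveVertex α (fibWord i n) (fibWord i n).length)

/-- The `n`-th `i`-Fibonacci curve with drawing angle `α`, scaled (about its starting point, the
origin) to width `√2`. -/
def scaledFibCurve (i : ℕ) (α : ℝ) (n : ℕ) :
    TopologicalSpace.NonemptyCompacts (EuclideanSpace ℝ (Fin 2)) :=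
  (wordCurveCompact α (fibWord i n)).map (fun x => (√2 / fibWidth i α n) • x)
    (continuous_const_smul _)

/-- The subsequence along which the scaling limit is taken: `6k + 5` for even `i` and `6k + 3` for
odd `i`. -/
def fibIndex (i k : ℕ) : ℕ := if Even i then 6 * k + 5 else 6 * k + 3

/-- The `i`-Fibonacci fractal with drawing angle `α`: the limit, in the Hausdorff metric, of the
scaled curves along the indices `fibIndex i k`. The value is meaningful only where this limit
exists. -/
def fibFractal (i : ℕ) (α : ℝ) :
    TopologicalSpace.NonemptyCompacts (EuclideanSpace ℝ (Fin 2)) :=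
  limUnder atTop fun k : ℕ => scaledFibCurve i α (fibIndex i k)

end

/-! Let zₙ be the displacement of the n-th word. Turns alternate with the parity of the position, so
a prefix acts on what follows it by a rotation, preceded by a reflection when its length is odd.
Hence zₙ₊₂ = zₙ₊₁ + Lₙ₊₁ zₙ with linear isometries Lₙ (`wordIsom`) that have period 6 in n. In
suitable coordinates three steps reduce to a real 2 × 2 recursion with dominant eigenvalue x, the
positive root of x² = 1 + 2(1 + c)x, where c = cos α (`displacement_closed_form`). So displacements
grow like μⁿ with μ = x^(1/3), and zₙ / μⁿ converges along each residue class modulo 6.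

The vertex sets obey the same recursion: the set of index n + 2 is that of index n + 1 together with
an isometric copy of that of index n. Unfolding 6m times cuts a curve into F₆ₘ₊₁ ≤ φ^(6m) pieces of
relative size O(μ^(-6m)), whose scaled starting points converge. Therefore the scaled curves form a
Cauchy sequence, and their limit has dimension at most log φ / log μ = 3 log φ / log x
(`exists_scaling_limit`). The dimension is at least 1, because the limit is approximated by
connected sets joining 0 to a point at distance √2. As α → 0, x tends to 2 + √5 = φ³ and the upper
bound tends to 1. -/

/-! ### Hausdorff limits and dimension bounds -/

open TopologicalSpace in
/-- A sequence of compact sets which, for every `ε`, is eventually `ε`-approximated by convergent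
finite families of its points is a Cauchy sequence for the Hausdorff metric. -/
theorem cauchySeq_of_finite_approx {X : Type*} [MetricSpace X] (S : ℕ → NonemptyCompacts X)
    (H : ∀ ε > 0, ∃ (m : ℕ) (ι : Type) (_ : Fintype ι) (P : ℕ → ι → X) (l : ι → X),
      (∀ k t, P k t ∈ S (k + m)) ∧
      (∀ᶠ k in atTop, ∀ x ∈ S (k + m), ∃ t, dist x (P k t) ≤ ε) ∧
      ∀ t, Tendsto (fun k => P k t) atTop (𝓝 (l t))) : CauchySeq S := by
  rw [Metric.cauchySeq_iff']
  intro ε hε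
  obtain ⟨m, ι, _, P, l, hP, hc, hl⟩ := H (ε / 4) (by positivity)
  have hl' : ∀ᶠ k in atTop, ∀ t, dist (P k t) (l t) < ε / 8 :=
    eventually_all.2 fun t => (Metric.tendsto_nhds.1 (hl t)) _ (by positivity)
  obtain ⟨N, hN⟩ := eventually_atTop.1 (hc.and hl')
  -- One index `t` labels a point in each set: x is within ε/4 of `P a t`, which is within ε/8 + ε/8
  -- of `P b t` through the common limit `l t`.
  have key : ∀ a ≥ N, ∀ b ≥ N, ∀ x ∈ S (a + m), ∃ y ∈ S (b + m), dist x y ≤ ε / 2 := by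
    intro a ha b hb x hx
    obtain ⟨t, ht⟩ := (hN a ha).1 x hx
    refine ⟨P b t, hP b t, ?_⟩
    have h1 := (hN a ha).2 t
    have h2 := (hN b hb).2 t
    have h3 := dist_triangle4_right (P a t) (P b t) (l t) (l t)
    have h4 := dist_triangle x (P a t) (P b t)
    have h5 := dist_triangle_right (P a t) (P b t) (l t)
    linarith
  refine ⟨N + m, fun n hn => ?_⟩
  obtain ⟨a, rfl⟩ := Nat.exists_eq_add_of_le' (le_trans (Nat.le_add_left m N) hn)
  have ha : N ≤ a := by omega
  rw [Metric.NonemptyCompacts.dist_eq]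
  refine lt_of_le_of_lt (Metric.hausdorffDist_le_of_mem_dist (r := ε / 2) (by positivity)
    (key a ha N le_rfl) ?_) (by linarith)
  exact key N le_rfl a ha

open TopologicalSpace in
theorem exists_mem_dist_lt_of_tendsto {X : Type*} [MetricSpace X] {S : ℕ → NonemptyCompacts X}
    {K : NonemptyCompacts X} (hK : Tendsto S atTop (𝓝 K)) {ε : ℝ} (hε : 0 < ε) :
    ∀ᶠ k in atTop, (∀ x ∈ S k, ∃ y ∈ K, dist x y < ε) ∧ ∀ x ∈ K, ∃ y ∈ S k, dist x y < ε := by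
  filter_upwards [Metric.tendsto_nhds.1 hK ε hε] with k hk
  have hfin : Metric.hausdorffEDist (S k : Set X) K ≠ ⊤ :=
    Metric.hausdorffEDist_ne_top_of_nonempty_of_bounded (S k).nonempty K.nonempty
      (S k).isCompact.isBounded K.isCompact.isBounded
  rw [Metric.NonemptyCompacts.dist_eq] at hk
  refine ⟨fun x hx => Metric.exists_dist_lt_of_hausdorffDist_lt hx hk hfin, fun x hx => ?_⟩
  rw [Metric.hausdorffDist_comm] at hk
  rw [Metric.hausdorffEDist_comm] at hfin
  exact Metric.exists_dist_lt_of_hausdorffDist_lt hx hk hfin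

open TopologicalSpace in
/-- A finite approximation of a sequence of compact sets gives a cover of its limit by balls. -/
theorem subset_iUnion_closedBall_of_finite_approx {X : Type*} [MetricSpace X]
    {S : ℕ → NonemptyCompacts X} {K : NonemptyCompacts X} (hK : Tendsto S atTop (𝓝 K))
    {ε : ℝ} (hε : 0 < ε) {m : ℕ} {ι : Type} [Fintype ι] {P : ℕ → ι → X} {l : ι → X}
    (hc : ∀ᶠ k in atTop, ∀ x ∈ S (k + m), ∃ t, dist x (P k t) ≤ ε)
    (hl : ∀ t, Tendsto (fun k => P k t) atTop (𝓝 (l t))) :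
    (K : Set X) ⊆ ⋃ t, Metric.closedBall (l t) (2 * ε) := by
  have hl' : ∀ᶠ k in atTop, ∀ t, dist (P k t) (l t) < ε / 2 :=
    eventually_all.2 fun t => (Metric.tendsto_nhds.1 (hl t)) _ (by positivity)
  have hd := (tendsto_add_atTop_nat m).eventually
    (exists_mem_dist_lt_of_tendsto hK (half_pos hε))
  obtain ⟨k, h1, h2, h3⟩ := (hc.and (hl'.and hd)).exists
  intro x hx
  obtain ⟨y, hy, hxy⟩ := h3.2 x hx
  obtain ⟨t, ht⟩ := h1 y hy
  refine Set.mem_iUnion.2 ⟨t, ?_⟩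
  rw [Metric.mem_closedBall]
  have := dist_triangle4 x y (P k t) (l t)
  have := h2 t
  linarith

/-- A set which, for every `m`, is covered by at most `a ^ m` balls of radius `C b⁻ᵐ` has
Hausdorff dimension at most `log a / log b`. -/
theorem dimH_le_of_covers {X : Type*} [MetricSpace X] {K : Set X} {a b C : ℝ} (ha : 1 ≤ a)
    (hb : 1 < b) (hC : 0 < C)
    (H : ∀ m : ℕ, ∃ (ι : Type) (_ : Fintype ι) (l : ι → X), (Fintype.card ι : ℝ) ≤ a ^ m ∧
      K ⊆ ⋃ t, Metric.closedBall (l t) (C * b⁻¹ ^ m)) :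
    dimH K ≤ ENNReal.ofReal (Real.log a / Real.log b) := by
  have hb0 : 0 < b := by linarith
  have hlb : 0 < Real.log b := Real.log_pos hb
  have hla : 0 ≤ Real.log a := Real.log_nonneg ha
  choose ι inst l hcard hcov using H
  let _ : MeasurableSpace X := borel X
  have _ : BorelSpace X := ⟨rfl⟩
  set d : NNReal := Real.toNNReal (Real.log a / Real.log b) with hd
  have hdr : (d : ℝ) = Real.log a / Real.log b := Real.coe_toNNReal _ (by positivity)
  change dimH K ≤ (d : ENNReal)
  refine dimH_le_of_hausdorffMeasure_ne_top ?_
  -- The exponent d satisfies b^d = a, so the d-th powers of the radii cancel the number of balls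
  -- and the Hausdorff sums stay bounded.
  have hpow : ∀ m : ℕ, (b⁻¹ ^ m) ^ (d : ℝ) = (a ^ m)⁻¹ := by
    intro m
    have : b ^ (d : ℝ) = a := by
      rw [Real.rpow_def_of_pos hb0, hdr, mul_div_cancel₀ _ hlb.ne', Real.exp_log (by linarith)]
    rw [← Real.rpow_natCast, ← Real.rpow_mul (by positivity), mul_comm, Real.rpow_mul
      (by positivity), Real.inv_rpow hb0.le, this, Real.rpow_natCast, inv_pow]
  have hdiam : ∀ m (t : ι m), Metric.ediam (Metric.closedBall (l m t) (C * b⁻¹ ^ m)) ≤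
      ENNReal.ofReal (2 * (C * b⁻¹ ^ m)) := by
    intro m t
    refine Metric.ediam_le_of_forall_dist_le fun x hx y hy => ?_
    have := dist_triangle_right x y (l m t)
    rw [Metric.mem_closedBall] at hx hy
    linarith
  have hr : Tendsto (fun m : ℕ => ENNReal.ofReal (2 * (C * b⁻¹ ^ m))) atTop (𝓝 0) := by
    rw [← ENNReal.ofReal_zero]
    refine ENNReal.tendsto_ofReal ?_
    have := (tendsto_pow_atTop_nhds_zero_of_lt_one (r := b⁻¹) (by positivity)
      (inv_lt_one_of_one_lt₀ hb)).const_mul C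
    simpa using this.const_mul 2
  have hle := MeasureTheory.Measure.hausdorffMeasure_le_liminf_sum (d : ℝ) K _ hr
    (fun m t => Metric.closedBall (l m t) (C * b⁻¹ ^ m)) (Eventually.of_forall hdiam)
    (Eventually.of_forall hcov)
  have hbound : ∀ m, ∑ t, Metric.ediam (Metric.closedBall (l m t) (C * b⁻¹ ^ m)) ^ (d : ℝ) ≤
      ENNReal.ofReal ((2 * C) ^ (d : ℝ)) := by
    intro m
    calc _ ≤ ∑ _t : ι m, ENNReal.ofReal ((2 * (C * b⁻¹ ^ m)) ^ (d : ℝ)) := by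
          refine Finset.sum_le_sum fun t _ => ?_
          rw [← ENNReal.ofReal_rpow_of_nonneg (by positivity) d.coe_nonneg]
          exact ENNReal.rpow_le_rpow (hdiam m t) d.coe_nonneg
      _ = ENNReal.ofReal (Fintype.card (ι m) * (2 * (C * b⁻¹ ^ m)) ^ (d : ℝ)) := by
          rw [ENNReal.ofReal_mul (by positivity)]
          simp
      _ ≤ _ := by
          refine ENNReal.ofReal_le_ofReal ?_
          rw [← mul_assoc, Real.mul_rpow (by positivity) (by positivity), hpow]
          have h1 := hcard m
          have h2 : 0 < a ^ m := by positivity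
          have h3 : 0 ≤ (2 * C) ^ (d : ℝ) := by positivity
          rw [mul_comm, mul_assoc]
          refine mul_le_of_le_one_right h3 ?_
          rw [inv_mul_le_iff₀ h2]
          simpa using h1
  refine ne_top_of_le_ne_top (ENNReal.ofReal_ne_top (r := (2 * C) ^ (d : ℝ))) (hle.trans ?_)
  exact (liminf_le_liminf (Eventually.of_forall hbound)).trans (by simp)

open TopologicalSpace in
/-- The limit of a sequence of connected compact sets containing the origin and a point at
distance `c > 0` from it has dimension at least one. -/
theorem one_le_dimH_of_tendsto_connected {E : Type*} [NormedAddCommGroup E]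
    {S : ℕ → NonemptyCompacts E} {K : NonemptyCompacts E} (hK : Tendsto S atTop (𝓝 K))
    {c : ℝ} (hc : 0 < c) (hS : ∀ᶠ k in atTop, IsPreconnected (S k : Set E) ∧ (0 : E) ∈ S k ∧
      ∃ x ∈ S k, ‖x‖ = c) : 1 ≤ dimH (K : Set E) := by
  -- On each connected `S k` the norm takes every value in [0, c]. These values pass to K because
  -- the image of K under the norm is closed.
  have hsub : Set.Icc 0 c ⊆ norm '' (K : Set E) := by
    intro t ht
    have hcl : IsClosed (norm '' (K : Set E)) := (K.isCompact.image continuous_norm).isClosed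
    rw [← hcl.closure_eq, Metric.mem_closure_iff]
    intro ε hε
    obtain ⟨k, ⟨hc1, h0, x, hx, hxc⟩, h2⟩ :=
      (hS.and (exists_mem_dist_lt_of_tendsto hK hε)).exists
    have himg := hc1.image norm continuous_norm.continuousOn
    have hmem := himg.Icc_subset ⟨0, h0, norm_zero⟩ ⟨x, hx, hxc⟩ ht
    obtain ⟨y, hy, rfl⟩ := hmem
    obtain ⟨w, hw, hyw⟩ := h2.1 y hy
    refine ⟨‖w‖, ⟨w, hw, rfl⟩, lt_of_le_of_lt ?_ hyw⟩
    rw [dist_eq_norm y w, Real.dist_eq]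
    exact abs_norm_sub_norm_le y w
  have h1 : dimH (Set.Icc 0 c) = 1 := by
    rw [Real.dimH_of_nonempty_interior]
    · simp
    · rw [interior_Icc]
      exact ⟨c / 2, by constructor <;> linarith⟩
  calc (1 : ENNReal) = dimH (Set.Icc 0 c) := h1.symm
    _ ≤ dimH (norm '' (K : Set E)) := dimH_mono hsub
    _ ≤ dimH (K : Set E) := lipschitzWith_one_norm.dimH_image_le _

/-! ### Concatenation of words as composition of plane motions -/

/-- The total change of direction along a word, in units of the drawing angle. -/
noncomputable def turnSum (w : List (Fin 2)) : ℝ :=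
  ∑ j ∈ Finset.range w.length, turn (j + 1) (w.getD j 1)

/-- Only the parity of a position matters, so an odd shift exchanges left and right. This is the
source of the reflections in `wordIsom`. -/
theorem turn_add (n j : ℕ) (b : Fin 2) : turn (n + j) b = (-1) ^ n * turn j b := by
  unfold turn
  by_cases hb : b = 0
  · simp only [hb, if_true, Nat.even_add]
    by_cases hn : Even n
    · simp [hn, hn.neg_one_pow]
    · have hn' := Nat.not_even_iff_odd.1 hn
      by_cases hj : Even j <;> simp [hn, hj, hn'.neg_one_pow]
  · simp [hb]

theorem turnSum_append (w v : List (Fin 2)) :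
    turnSum (w ++ v) = turnSum w + (-1) ^ w.length * turnSum v := by
  unfold turnSum
  rw [List.length_append, Finset.sum_range_add, Finset.mul_sum]
  congr 1
  · refine Finset.sum_congr rfl fun j hj => ?_
    rw [List.getD_append _ _ _ _ (Finset.mem_range.1 hj)]
  · refine Finset.sum_congr rfl fun j hj => ?_
    rw [List.getD_append_right _ _ _ _ (Nat.le_add_right _ _), Nat.add_sub_cancel_left, add_assoc,
      turn_add]

/-- The `k`-th vertex of the curve of `w` in the complex plane, with initial direction `1`. -/
noncomputable def relVertex (α : ℝ) (w : List (Fin 2)) (k : ℕ) : ℂ :=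
  ∑ j ∈ Finset.range k, Complex.exp ((α * turnSum (w.take j) : ℝ) * Complex.I)

/-- The linear part of the motion that carries the curve of `v` to the part of the curve of
`w ++ v` drawn by `v`. -/
noncomputable def wordIsom (α : ℝ) (w : List (Fin 2)) : ℂ ≃ₗᵢ[ℝ] ℂ :=
  if Even w.length then rotation (Circle.exp (α * turnSum w))
  else Complex.conjLIE.trans (rotation (Circle.exp (α * turnSum w)))

/-- The displacement from the first to the last vertex. -/
noncomputable def wordEnd (α : ℝ) (w : List (Fin 2)) : ℂ := relVertex α w w.length

/-- The set of vertices of the curve of a word. -/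
def vertexSet (α : ℝ) (w : List (Fin 2)) : Set ℂ := {x | ∃ k ≤ w.length, relVertex α w k = x}

theorem wordIsom_of_even {α : ℝ} {w : List (Fin 2)} (h : Even w.length) (x : ℂ) :
    wordIsom α w x = Complex.exp ((α * turnSum w : ℝ) * Complex.I) * x := by
  simp [wordIsom, h, rotation_apply]

theorem wordIsom_of_odd {α : ℝ} {w : List (Fin 2)} (h : Odd w.length) (x : ℂ) :
    wordIsom α w x = Complex.exp ((α * turnSum w : ℝ) * Complex.I) * (starRingEnd ℂ) x := by
  simp [wordIsom, Nat.not_even_iff_odd.2 h, rotation_apply]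

theorem relVertex_append_of_le (α : ℝ) (w v : List (Fin 2)) {k : ℕ} (hk : k ≤ w.length) :
    relVertex α (w ++ v) k = relVertex α w k := by
  refine Finset.sum_congr rfl fun j hj => ?_
  rw [List.take_append_of_le_length (by have := Finset.mem_range.1 hj; omega)]

theorem relVertex_append (α : ℝ) (w v : List (Fin 2)) (k : ℕ) :
    relVertex α (w ++ v) (w.length + k) = wordEnd α w + wordIsom α w (relVertex α v k) := by
  have h1 := relVertex_append_of_le α w v le_rfl
  unfold relVertex at h1
  unfold wordEnd relVertex
  rw [Finset.sum_range_add, h1, map_sum]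
  congr 1
  refine Finset.sum_congr rfl fun j _ => ?_
  rw [List.take_length_add_append, turnSum_append]
  rcases Nat.even_or_odd w.length with h | h
  · rw [wordIsom_of_even h, h.neg_one_pow, ← Complex.exp_add]
    congr 1
    push_cast
    ring
  · rw [wordIsom_of_odd h, h.neg_one_pow, ← Complex.exp_conj, ← Complex.exp_add]
    congr 1
    simp only [map_mul, Complex.conj_ofReal, Complex.conj_I]
    push_cast
    ring

theorem wordEnd_append (α : ℝ) (w v : List (Fin 2)) :
    wordEnd α (w ++ v) = wordEnd α w + wordIsom α w (wordEnd α v) := by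
  rw [wordEnd, List.length_append, relVertex_append]
  rfl

theorem vertexSet_append (α : ℝ) (w v : List (Fin 2)) :
    vertexSet α (w ++ v) =
      vertexSet α w ∪ (fun x => wordEnd α w + wordIsom α w x) '' vertexSet α v := by
  ext x
  constructor
  · rintro ⟨k, hk, rfl⟩
    rw [List.length_append] at hk
    rcases le_total k w.length with h | h
    · exact Or.inl ⟨k, h, (relVertex_append_of_le α w v h).symm⟩
    · obtain ⟨k, rfl⟩ := Nat.exists_eq_add_of_le h
      exact Or.inr ⟨_, ⟨k, by omega, rfl⟩, (relVertex_append α w v k).symm⟩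
  · rintro (⟨k, hk, rfl⟩ | ⟨_, ⟨k, hk, rfl⟩, rfl⟩)
    · exact ⟨k, by rw [List.length_append]; omega, relVertex_append_of_le α w v hk⟩
    · exact ⟨w.length + k, by rw [List.length_append]; omega, relVertex_append α w v k⟩

theorem zero_mem_vertexSet (α : ℝ) (w : List (Fin 2)) : (0 : ℂ) ∈ vertexSet α w :=
  ⟨0, Nat.zero_le _, by simp [relVertex]⟩

theorem finite_vertexSet (α : ℝ) (w : List (Fin 2)) : (vertexSet α w).Finite :=
  (Set.finite_Iic w.length).image _

/-! ### Transfer to the Euclidean plane -/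

/-- The isometry of the complex plane with the Euclidean plane which carries the direction `1` to
the direction `π / 2`. -/
noncomputable def planeIsom : ℂ ≃ₗᵢ[ℝ] EuclideanSpace ℝ (Fin 2) :=
  (rotation (Circle.exp (Real.pi / 2))).trans Complex.orthonormalBasisOneI.repr

theorem planeIsom_exp (t : ℝ) : planeIsom (Complex.exp (t * Complex.I)) =
    !₂[Real.cos (Real.pi / 2 + t), Real.sin (Real.pi / 2 + t)] := by
  have h : (rotation (Circle.exp (Real.pi / 2))) (Complex.exp (t * Complex.I)) =
      Complex.exp ((Real.pi / 2 + t : ℝ) * Complex.I) := by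
    rw [rotation_apply, Circle.coe_exp, ← Complex.exp_add]
    congr 1
    push_cast
    ring
  rw [planeIsom, LinearIsometryEquiv.trans_apply, h, Complex.exp_mul_I, ← Complex.ofReal_cos,
    ← Complex.ofReal_sin]
  generalize Real.pi / 2 + t = s
  ext j
  fin_cases j <;> simp [Complex.orthonormalBasisOneI, Complex.cos_ofReal_re, Complex.sin_ofReal_re]

theorem curveVertex_eq (α : ℝ) (w : List (Fin 2)) (k : ℕ) :
    curveVertex α w k = planeIsom (relVertex α w k) := by
  unfold curveVertex relVertex
  rw [map_sum]
  exact Finset.sum_congr rfl fun j _ => (planeIsom_exp _).symm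

theorem curveVertex_zero (α : ℝ) (w : List (Fin 2)) : curveVertex α w 0 = 0 := by
  simp [curveVertex]

theorem norm_wordEnd (α : ℝ) (w : List (Fin 2)) :
    dist (curveVertex α w 0) (curveVertex α w w.length) = ‖wordEnd α w‖ := by
  rw [curveVertex_zero, dist_zero_left, curveVertex_eq, LinearIsometryEquiv.norm_map, wordEnd]

theorem dist_curveVertex_succ (α : ℝ) (w : List (Fin 2)) (k : ℕ) :
    dist (curveVertex α w (k + 1)) (curveVertex α w k) = 1 := by
  rw [curveVertex_eq, curveVertex_eq, LinearIsometryEquiv.dist_map, dist_eq_norm, relVertex,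
    Finset.sum_range_succ, relVertex, add_sub_cancel_left, Complex.norm_exp_ofReal_mul_I]

theorem curveVertex_mem_wordCurve (α : ℝ) (w : List (Fin 2)) {k : ℕ} (hk : k ≤ w.length) :
    curveVertex α w k ∈ wordCurve α w := by
  rcases k with _ | k
  · exact Or.inl (by simp [curveVertex_zero])
  · refine Or.inr (Set.mem_biUnion (x := k) ?_ (right_mem_segment _ _ _))
    simpa using hk

theorem planeIsom_mem_wordCurve {α : ℝ} {w : List (Fin 2)} {x : ℂ} (hx : x ∈ vertexSet α w) :
    planeIsom x ∈ wordCurve α w := by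
  obtain ⟨k, hk, rfl⟩ := hx
  rw [← curveVertex_eq]
  exact curveVertex_mem_wordCurve α w hk

theorem exists_vertex_dist_le {α : ℝ} {w : List (Fin 2)} {x : EuclideanSpace ℝ (Fin 2)}
    (hx : x ∈ wordCurve α w) : ∃ y ∈ vertexSet α w, dist x (planeIsom y) ≤ 1 := by
  rcases hx with hx | hx
  · rw [Set.mem_singleton_iff] at hx
    exact ⟨0, zero_mem_vertexSet α w, by simp [hx]⟩
  · obtain ⟨k, hk, hx⟩ := Set.mem_iUnion₂.1 hx
    refine ⟨relVertex α w k, ⟨k, (Finset.mem_range.1 hk).le, rfl⟩, ?_⟩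
    rw [← curveVertex_eq]
    have hsub : segment ℝ (curveVertex α w k) (curveVertex α w (k + 1)) ⊆
        Metric.closedBall (curveVertex α w k) 1 := by
      refine (convex_closedBall _ _).segment_subset (by simp) ?_
      rw [Metric.mem_closedBall, dist_curveVertex_succ]
    exact hsub hx

theorem isPreconnected_wordCurve (α : ℝ) (w : List (Fin 2)) : IsPreconnected (wordCurve α w) := by
  have key : ∀ n, IsPreconnected (({0} : Set (EuclideanSpace ℝ (Fin 2))) ∪
      ⋃ k ∈ Finset.range n, segment ℝ (curveVertex α w k) (curveVertex α w (k + 1))) ∧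
      curveVertex α w n ∈ (({0} : Set (EuclideanSpace ℝ (Fin 2))) ∪
      ⋃ k ∈ Finset.range n, segment ℝ (curveVertex α w k) (curveVertex α w (k + 1))) := by
    intro n
    induction n with
    | zero => simp [isPreconnected_singleton, curveVertex_zero]
    | succ n ih =>
      rw [Finset.range_add_one, Finset.set_biUnion_insert, Set.union_left_comm, Set.union_comm]
      exact ⟨ih.1.union _ ih.2 (left_mem_segment _ _ _)
        (convex_segment _ _).isPreconnected, Or.inr (right_mem_segment _ _ _)⟩
  exact (key w.length).1

/-! ### Sets with a Fibonacci-type recursion by 6-periodic isometries -/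

theorem apply_six_mul_add {β : Type*} {f : ℕ → β} (hf : ∀ n, f (n + 6) = f n) (k n : ℕ) :
    f (6 * k + n) = f n := by
  induction k with
  | zero => simp
  | succ k ih => rw [← ih, ← hf (6 * k + n)]; congr 1; ring

section SelfSimilar

variable {V : ℕ → Set ℂ} {z : ℕ → ℂ} {L : ℕ → ℂ ≃ₗᵢ[ℝ] ℂ} {μ : ℝ}

/-- If a sequence with 6-periodic isometric recursion is asymptotically geometric along two
consecutive residues modulo 6, it is so along all residues. -/
theorem exists_tendsto_residue (hL : ∀ n, L (n + 6) = L n)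
    (hz : ∀ n, z (n + 2) = z (n + 1) + L (n + 1) (z n))
    (h0 : ∃ l, Tendsto (fun k => ((μ ^ 6) ^ k)⁻¹ • z (6 * k)) atTop (𝓝 l))
    (h1 : ∃ l, Tendsto (fun k => ((μ ^ 6) ^ k)⁻¹ • z (6 * k + 1)) atTop (𝓝 l)) (r : ℕ) :
    ∃ l, Tendsto (fun k => ((μ ^ 6) ^ k)⁻¹ • z (6 * k + r)) atTop (𝓝 l) := by
  have hL' := apply_six_mul_add hL
  induction r using Nat.twoStepInduction with
  | zero => exact h0
  | one => exact h1
  | more r ih0 ih1 =>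
    obtain ⟨l0, hl0⟩ := ih0
    obtain ⟨l1, hl1⟩ := ih1
    refine ⟨l1 + L (r + 1) l0, ?_⟩
    refine (hl1.add (((L (r + 1)).continuous.tendsto _).comp hl0)).congr fun k => ?_
    rw [show 6 * k + (r + 2) = 6 * k + r + 2 by ring, hz, smul_add, Function.comp_apply, map_smul,
      Nat.add_assoc _ r 1, hL']

theorem exists_norm_le_of_tendsto_residue (hμ : 1 < μ)
    (h : ∀ r, ∃ l, Tendsto (fun k => ((μ ^ 6) ^ k)⁻¹ • z (6 * k + r)) atTop (𝓝 l)) :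
    ∃ C, 0 < C ∧ ∀ n, ‖z n‖ ≤ C * μ ^ n := by
  have hμ0 : 0 < μ := by linarith
  have hb : ∀ r, ∃ C, ∀ k, ‖((μ ^ 6) ^ k)⁻¹ • z (6 * k + r)‖ ≤ C := by
    intro r
    obtain ⟨l, hl⟩ := h r
    obtain ⟨C, hC⟩ := (Metric.isBounded_range_of_tendsto _ hl).exists_norm_le
    exact ⟨C, fun k => hC _ ⟨k, rfl⟩⟩
  choose C hC using hb
  have hC0 : ∀ r, 0 ≤ C r := fun r => (norm_nonneg _).trans (hC r 0)
  refine ⟨∑ r ∈ Finset.range 6, C r + 1, ?_, fun n => ?_⟩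
  · have := Finset.sum_nonneg fun r (_ : r ∈ Finset.range 6) => hC0 r
    linarith
  · have h1 := hC (n % 6) (n / 6)
    have hn : 6 * (n / 6) + n % 6 = n := Nat.div_add_mod n 6
    have hp : 0 < (μ ^ 6) ^ (n / 6) := by positivity
    rw [hn, norm_smul, norm_inv, Real.norm_of_nonneg hp.le, inv_mul_le_iff₀ hp] at h1
    have h2 : C (n % 6) ≤ ∑ r ∈ Finset.range 6, C r + 1 := by
      have := Finset.single_le_sum (f := C) (fun r _ => hC0 r)
        (Finset.mem_range.2 (Nat.mod_lt n (by norm_num : 0 < 6)))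
      linarith
    have h3 : (μ ^ 6) ^ (n / 6) ≤ μ ^ n := by
      rw [← pow_mul]
      exact pow_le_pow_right₀ hμ.le (by omega)
    calc ‖z n‖ ≤ (μ ^ 6) ^ (n / 6) * C (n % 6) := h1
      _ ≤ μ ^ n * (∑ r ∈ Finset.range 6, C r + 1) :=
        mul_le_mul h3 h2 (hC0 _) (by positivity)
      _ = _ := mul_comm _ _

/-- The radius at n + 2 is at most the larger of the radius at n + 1 and ‖zₙ₊₁‖ plus the radius at
n. Since μ > 1, a bound of order μⁿ on the displacements propagates to the radii. -/
theorem exists_radius_le (hμ : 1 < μ)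
    (hV : ∀ n, V (n + 2) = V (n + 1) ∪ (fun x => z (n + 1) + L (n + 1) x) '' V n)
    (hfin : ∀ n, (V n).Finite) (hz : ∃ C, 0 < C ∧ ∀ n, ‖z n‖ ≤ C * μ ^ n) :
    ∃ C, 0 < C ∧ ∀ n, ∀ x ∈ V n, ‖x‖ ≤ C * μ ^ n := by
  have hμ0 : 0 < μ := by linarith
  obtain ⟨Cz, hCz, hz⟩ := hz
  obtain ⟨C0, hC0⟩ := (hfin 0).isBounded.exists_norm_le
  obtain ⟨C1, hC1⟩ := (hfin 1).isBounded.exists_norm_le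
  -- For C ≥ D one has Cz μ + C ≤ C μ², which is what the inductive step needs.
  set D := Cz * μ / (μ ^ 2 - 1) with hD
  have hμ2 : 0 < μ ^ 2 - 1 := by nlinarith
  have hD0 : 0 < D := by positivity
  refine ⟨|C0| + |C1| + D, by positivity, fun n => ?_⟩
  set C := |C0| + |C1| + D
  have hC : 0 < C := by positivity
  induction n using Nat.twoStepInduction with
  | zero =>
    intro x hx
    have := hC0 x hx
    have := le_abs_self C0
    have := abs_nonneg C1
    simp only [pow_zero, mul_one, C]
    linarith
  | one =>
    intro x hx
    have := hC1 x hx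
    have := le_abs_self C1
    have := abs_nonneg C0
    have h : C1 ≤ C := by simp only [C]; linarith
    rw [pow_one]
    nlinarith
  | more n ih0 ih1 =>
    intro x hx
    rw [hV] at hx
    have hpn : 0 < μ ^ n := by positivity
    rcases hx with hx | ⟨y, hy, rfl⟩
    · refine (ih1 x hx).trans ?_
      gcongr
      · exact hμ.le
      · omega
    · have h1 := hz (n + 1)
      have h2 := ih0 y hy
      have h3 : Cz * μ ≤ C * (μ ^ 2 - 1) := by
        have : D * (μ ^ 2 - 1) = Cz * μ := by rw [hD]; field_simp
        rw [← this]
        refine mul_le_mul_of_nonneg_right ?_ hμ2.le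
        have := abs_nonneg C0
        have := abs_nonneg C1
        simp only [C]
        linarith
      calc ‖z (n + 1) + L (n + 1) y‖ ≤ ‖z (n + 1)‖ + ‖L (n + 1) y‖ := norm_add_le _ _
        _ ≤ Cz * μ ^ (n + 1) + C * μ ^ n := by
          rw [LinearIsometryEquiv.norm_map]; exact add_le_add h1 h2
        _ = (Cz * μ + C) * μ ^ n := by ring
        _ ≤ (C * μ ^ 2) * μ ^ n := by gcongr; linarith
        _ = C * μ ^ (n + 2) := by ring

/-- Decomposing `j` times, the sets `V (6 k + r + j)` are approximated by `fib (j + 1)` of their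
points, up to the diameter of the undecomposed pieces. -/
theorem exists_finite_approx (hμ : 1 < μ) (hL : ∀ n, L (n + 6) = L n)
    (hV : ∀ n, V (n + 2) = V (n + 1) ∪ (fun x => z (n + 1) + L (n + 1) x) '' V n)
    (h0 : ∀ n, (0 : ℂ) ∈ V n)
    (hz : ∀ r, ∃ l, Tendsto (fun k => ((μ ^ 6) ^ k)⁻¹ • z (6 * k + r)) atTop (𝓝 l))
    {C : ℝ} (hC : 0 < C) (hR : ∀ n, ∀ x ∈ V n, ‖x‖ ≤ C * μ ^ n) (r j : ℕ) :
    ∃ (ι : Type) (_ : Fintype ι) (P : ℕ → ι → ℂ), Fintype.card ι = Nat.fib (j + 1) ∧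
      (∀ k t, P k t ∈ V (6 * k + r + j)) ∧
      (∀ k, ∀ x ∈ V (6 * k + r + j), ∃ t, dist x (P k t) ≤ C * μ ^ (6 * k + r + 1)) ∧
      ∀ t, ∃ l, Tendsto (fun k => ((μ ^ 6) ^ k)⁻¹ • P k t) atTop (𝓝 l) := by
  have hL' := apply_six_mul_add hL
  induction j using Nat.twoStepInduction with
  | zero =>
    -- Pieces of index 6k + r and 6k + r + 1 are left whole and represented by their starting point.
    -- The exponent 6k + r + 1 bounds the radius of both kinds.
    refine ⟨Unit, inferInstance, fun _ _ => 0, by simp, fun k _ => h0 _, fun k x hx => ⟨(), ?_⟩,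
      fun _ => ⟨0, by simp⟩⟩
    rw [dist_zero_right]
    refine (hR _ x hx).trans ?_
    gcongr
    · exact hμ.le
    · omega
  | one =>
    refine ⟨Unit, inferInstance, fun _ _ => 0, by simp, fun k _ => h0 _, fun k x hx => ⟨(), ?_⟩,
      fun _ => ⟨0, by simp⟩⟩
    rw [dist_zero_right]
    exact hR _ x hx
  | more j ih0 ih1 =>
    obtain ⟨ι0, _, P0, hcard0, hm0, hc0, hl0⟩ := ih0
    obtain ⟨ι1, _, P1, hcard1, hm1, hc1, hl1⟩ := ih1
    have hV' : ∀ k, V (6 * k + r + (j + 2)) = V (6 * k + r + (j + 1)) ∪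
        (fun x => z (6 * k + (r + j + 1)) + L (r + j + 1) x) '' V (6 * k + r + j) := by
      intro k
      have h := hV (6 * k + r + j)
      have e : 6 * k + r + j + 1 = 6 * k + (r + j + 1) := by ring
      rw [e, hL'] at h
      rw [show 6 * k + r + (j + 2) = 6 * k + r + j + 2 by ring, h,
        show 6 * k + r + (j + 1) = 6 * k + (r + j + 1) by ring]
    refine ⟨ι1 ⊕ ι0, inferInstance, fun k => Sum.elim (P1 k)
      fun t => z (6 * k + (r + j + 1)) + L (r + j + 1) (P0 k t), ?_, ?_, ?_, ?_⟩
    · rw [Fintype.card_sum, hcard0, hcard1, Nat.fib_add_two (n := j + 1), add_comm]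
    · intro k t
      rw [hV']
      rcases t with t | t
      · exact Or.inl (hm1 k t)
      · exact Or.inr ⟨_, hm0 k t, rfl⟩
    · intro k x hx
      rw [hV'] at hx
      rcases hx with hx | ⟨y, hy, rfl⟩
      · obtain ⟨t, ht⟩ := hc1 k x hx
        exact ⟨Sum.inl t, ht⟩
      · obtain ⟨t, ht⟩ := hc0 k y hy
        refine ⟨Sum.inr t, ?_⟩
        simpa using ht
    · rintro (t | t)
      · exact hl1 t
      · obtain ⟨l, hl⟩ := hl0 t
        obtain ⟨l', hl'⟩ := hz (r + j + 1)
        refine ⟨l' + L (r + j + 1) l, ?_⟩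
        refine (hl'.add (((L (r + j + 1)).continuous.tendsto _).comp hl)).congr fun k => ?_
        simp only [Sum.elim_inr]
        rw [smul_add, Function.comp_apply, map_smul]

end SelfSimilar

/-! ### Existence and dimension of scaling limits -/

theorem fib_succ_le_goldenRatio_pow (n : ℕ) : (Nat.fib (n + 1) : ℝ) ≤ Real.goldenRatio ^ n := by
  have h := Real.goldenRatio_mul_fib_succ_add_fib n
  have h0 : (0 : ℝ) ≤ Nat.fib n := Nat.cast_nonneg _
  have hφ := Real.goldenRatio_pos
  rw [pow_succ'] at h
  exact le_of_mul_le_mul_left (by linarith) hφ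

section ScalingLimit

variable {α μ : ℝ} {h : ℕ → List (Fin 2)} {ρ : ℕ} {l : ℂ}
  {S : ℕ → TopologicalSpace.NonemptyCompacts (EuclideanSpace ℝ (Fin 2))}

/-- One family of points serves two purposes: its convergence makes the curves Cauchy, and its
cardinality and precision bound the dimension of the limit. -/
theorem exists_finite_approx_scaled (hμ : 1 < μ) (hh : ∀ n, h (n + 2) = h (n + 1) ++ h n)
    (hL : ∀ n, wordIsom α (h (n + 6)) = wordIsom α (h n))
    (h0 : ∃ l, Tendsto (fun k => ((μ ^ 6) ^ k)⁻¹ • wordEnd α (h (6 * k))) atTop (𝓝 l))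
    (h1 : ∃ l, Tendsto (fun k => ((μ ^ 6) ^ k)⁻¹ • wordEnd α (h (6 * k + 1))) atTop (𝓝 l))
    (hl : Tendsto (fun k => ((μ ^ 6) ^ k)⁻¹ • wordEnd α (h (6 * k + ρ))) atTop (𝓝 l))
    (hl0 : l ≠ 0)
    (hS : ∀ k, (S k : Set (EuclideanSpace ℝ (Fin 2))) =
      (fun x => (√2 / ‖wordEnd α (h (6 * k + ρ))‖) • x) '' wordCurve α (h (6 * k + ρ))) :
    ∃ C : ℝ, 0 < C ∧ ∀ m : ℕ, ∃ (ι : Type) (_ : Fintype ι)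
      (P : ℕ → ι → EuclideanSpace ℝ (Fin 2)) (p : ι → EuclideanSpace ℝ (Fin 2)),
      (Fintype.card ι : ℝ) ≤ (Real.goldenRatio ^ 6) ^ m ∧ (∀ k t, P k t ∈ S (k + m)) ∧
      (∀ᶠ k in atTop, ∀ x ∈ S (k + m), ∃ t, dist x (P k t) ≤ C * (μ ^ 6)⁻¹ ^ m) ∧
      ∀ t, Tendsto (fun k => P k t) atTop (𝓝 (p t)) := by
  have hμ0 : 0 < μ := by linarith
  have hV : ∀ n, vertexSet α (h (n + 2)) = vertexSet α (h (n + 1)) ∪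
      (fun x => wordEnd α (h (n + 1)) + wordIsom α (h (n + 1)) x) '' vertexSet α (h n) :=
    fun n => by rw [hh, vertexSet_append]
  have hz := exists_tendsto_residue (z := fun n => wordEnd α (h n))
    (L := fun n => wordIsom α (h n)) hL (fun n => by simp only [hh, wordEnd_append]) h0 h1
  obtain ⟨C, hC, hR⟩ := exists_radius_le (z := fun n => wordEnd α (h n))
    (L := fun n => wordIsom α (h n)) hμ hV (fun n => finite_vertexSet α (h n))
    (exists_norm_le_of_tendsto_residue hμ hz)
  have hl' : 0 < ‖l‖ := norm_pos_iff.2 hl0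
  set σ : ℕ → ℝ := fun k => √2 / ‖wordEnd α (h (6 * k + ρ))‖ with hσ
  have hσ0 : ∀ k, 0 ≤ σ k := fun k => by positivity
  -- The curve of index 6(k + m) + ρ is cut into pieces of size about μ^(6k), so its scale factor
  -- σ(k + m) leaves them at size about μ^(-6m).
  have hσlim : ∀ m : ℕ, Tendsto (fun k => σ (k + m) * (μ ^ 6) ^ k) atTop
      (𝓝 (√2 / ‖l‖ * (μ ^ 6)⁻¹ ^ m)) := by
    intro m
    have h2 := ((hl.norm.comp (tendsto_add_atTop_nat m)).inv₀ hl'.ne').const_mul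
      (√2 * (μ ^ 6)⁻¹ ^ m)
    have e : √2 / ‖l‖ * (μ ^ 6)⁻¹ ^ m = √2 * (μ ^ 6)⁻¹ ^ m * ‖l‖⁻¹ := by ring
    rw [e]
    refine h2.congr fun k => ?_
    have hp : 0 < (μ ^ 6) ^ (k + m) := by positivity
    rw [Function.comp_apply, norm_smul, norm_inv, Real.norm_of_nonneg hp.le, mul_inv, inv_inv,
      hσ, pow_add, inv_pow]
    field_simp
  have hc0 : 0 < 1 + C * μ ^ (ρ + 1) := by positivity
  -- The factor 2 absorbs the error in the limit of the scale. The summand 1 is the distance from a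
  -- curve point to a vertex, and `C * μ ^ (ρ + 1)` comes from the radius of a piece.
  refine ⟨2 * √2 / ‖l‖ * (1 + C * μ ^ (ρ + 1)), by positivity, fun m => ?_⟩
  obtain ⟨ι, _, P, hcard, hm, hc, hlim⟩ := exists_finite_approx
    (z := fun n => wordEnd α (h n)) (L := fun n => wordIsom α (h n)) hμ hL hV
    (fun n => zero_mem_vertexSet α (h n)) hz hC hR ρ (6 * m)
  choose p hp using hlim
  have hidx : ∀ k, 6 * k + ρ + 6 * m = 6 * (k + m) + ρ := fun k => by ring
  refine ⟨ι, inferInstance, fun k t => σ (k + m) • planeIsom (P k t),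
    fun t => (√2 / ‖l‖ * (μ ^ 6)⁻¹ ^ m) • planeIsom (p t), ?_, ?_, ?_, ?_⟩
  · rw [hcard, ← pow_mul]
    exact fib_succ_le_goldenRatio_pow _
  · intro k t
    rw [← SetLike.mem_coe, hS]
    refine ⟨_, planeIsom_mem_wordCurve ?_, rfl⟩
    rw [← hidx]
    exact hm k t
  · have hlt : √2 / ‖l‖ * (μ ^ 6)⁻¹ ^ m < 2 * √2 / ‖l‖ * (μ ^ 6)⁻¹ ^ m := by
      have : 0 < √2 / ‖l‖ * (μ ^ 6)⁻¹ ^ m := by positivity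
      have e : 2 * √2 / ‖l‖ * (μ ^ 6)⁻¹ ^ m = 2 * (√2 / ‖l‖ * (μ ^ 6)⁻¹ ^ m) := by ring
      linarith
    filter_upwards [(hσlim m).eventually_lt_const hlt] with k hk x hx
    rw [← SetLike.mem_coe, hS] at hx
    obtain ⟨y, hy, rfl⟩ := hx
    obtain ⟨v, hv, hyv⟩ := exists_vertex_dist_le hy
    rw [← hidx] at hv
    obtain ⟨t, ht⟩ := hc k v hv
    refine ⟨t, ?_⟩
    change dist (σ (k + m) • y) (σ (k + m) • planeIsom (P k t)) ≤ _
    rw [dist_smul₀, Real.norm_of_nonneg (hσ0 _)]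
    have h3 : dist y (planeIsom (P k t)) ≤ (μ ^ 6) ^ k * (1 + C * μ ^ (ρ + 1)) := by
      have h4 := dist_triangle y (planeIsom v) (planeIsom (P k t))
      rw [LinearIsometryEquiv.dist_map] at h4
      have h5 : C * μ ^ (6 * k + ρ + 1) = (μ ^ 6) ^ k * (C * μ ^ (ρ + 1)) := by
        rw [← pow_mul]; ring
      have h6 : 1 ≤ (μ ^ 6) ^ k := one_le_pow₀ (one_le_pow₀ hμ.le)
      rw [mul_add, mul_one, ← h5]
      linarith
    calc σ (k + m) * dist y (planeIsom (P k t))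
        ≤ σ (k + m) * ((μ ^ 6) ^ k * (1 + C * μ ^ (ρ + 1))) :=
          mul_le_mul_of_nonneg_left h3 (hσ0 _)
      _ = σ (k + m) * (μ ^ 6) ^ k * (1 + C * μ ^ (ρ + 1)) := by ring
      _ ≤ 2 * √2 / ‖l‖ * (μ ^ 6)⁻¹ ^ m * (1 + C * μ ^ (ρ + 1)) :=
          mul_le_mul_of_nonneg_right hk.le hc0.le
      _ = _ := by ring
  · intro t
    refine ((hσlim m).smul ((planeIsom.continuous.tendsto _).comp (hp t))).congr fun k => ?_
    have hpk : (μ ^ 6) ^ k ≠ 0 := by positivity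
    rw [Function.comp_apply, map_smul, smul_smul, mul_assoc, mul_inv_cancel₀ hpk, mul_one]

/-- The scaling limit exists, and its Hausdorff dimension lies between `1` and `log φ / log μ`,
where `μ` is the growth rate of the displacement. -/
theorem exists_scaling_limit (hμ : 1 < μ) (hh : ∀ n, h (n + 2) = h (n + 1) ++ h n)
    (hL : ∀ n, wordIsom α (h (n + 6)) = wordIsom α (h n))
    (h0 : ∃ l, Tendsto (fun k => ((μ ^ 6) ^ k)⁻¹ • wordEnd α (h (6 * k))) atTop (𝓝 l))
    (h1 : ∃ l, Tendsto (fun k => ((μ ^ 6) ^ k)⁻¹ • wordEnd α (h (6 * k + 1))) atTop (𝓝 l))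
    (hl : Tendsto (fun k => ((μ ^ 6) ^ k)⁻¹ • wordEnd α (h (6 * k + ρ))) atTop (𝓝 l))
    (hl0 : l ≠ 0)
    (hS : ∀ k, (S k : Set (EuclideanSpace ℝ (Fin 2))) =
      (fun x => (√2 / ‖wordEnd α (h (6 * k + ρ))‖) • x) '' wordCurve α (h (6 * k + ρ))) :
    ∃ K, Tendsto S atTop (𝓝 K) ∧ 1 ≤ dimH (K : Set (EuclideanSpace ℝ (Fin 2))) ∧
      dimH (K : Set (EuclideanSpace ℝ (Fin 2))) ≤
        ENNReal.ofReal (Real.log Real.goldenRatio / Real.log μ) := by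
  have hμ0 : 0 < μ := by linarith
  have hμ6 : 1 < μ ^ 6 := one_lt_pow₀ hμ (by norm_num)
  obtain ⟨C, hC, H⟩ := exists_finite_approx_scaled hμ hh hL h0 h1 hl hl0 hS
  have hcauchy : CauchySeq S := by
    refine cauchySeq_of_finite_approx S fun ε hε => ?_
    have hlim := (tendsto_pow_atTop_nhds_zero_of_lt_one (r := (μ ^ 6)⁻¹) (by positivity)
      (inv_lt_one_of_one_lt₀ hμ6)).const_mul C
    rw [mul_zero] at hlim
    obtain ⟨m, hm⟩ := (hlim.eventually_lt_const hε).exists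
    obtain ⟨ι, _, P, p, -, hP, hc, hp⟩ := H m
    refine ⟨m, ι, inferInstance, P, p, hP, hc.mono fun k hk x hx => ?_, hp⟩
    obtain ⟨t, ht⟩ := hk x hx
    exact ⟨t, ht.trans hm.le⟩
  obtain ⟨K, hK⟩ := cauchySeq_tendsto_of_complete hcauchy
  refine ⟨K, hK, ?_, ?_⟩
  · refine one_le_dimH_of_tendsto_connected hK (c := √2) (by positivity) ?_
    filter_upwards [hl.eventually_ne hl0] with k hk
    have hw : wordEnd α (h (6 * k + ρ)) ≠ 0 := fun h => hk (by rw [h, smul_zero])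
    have hw' := norm_pos_iff.2 hw
    refine ⟨?_, ?_, ?_⟩
    · rw [hS]
      exact (isPreconnected_wordCurve _ _).image _ (by fun_prop)
    · rw [← SetLike.mem_coe, hS]
      exact ⟨0, Or.inl rfl, smul_zero _⟩
    · refine ⟨(√2 / ‖wordEnd α (h (6 * k + ρ))‖) • planeIsom (wordEnd α (h (6 * k + ρ))), ?_, ?_⟩
      · rw [← SetLike.mem_coe, hS]
        exact ⟨_, planeIsom_mem_wordCurve ⟨_, le_rfl, rfl⟩, rfl⟩
      · rw [norm_smul, LinearIsometryEquiv.norm_map, Real.norm_of_nonneg (by positivity)]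
        field_simp
  -- The radius doubles when the approximation of the curves becomes a cover of their limit.
  · have hle := dimH_le_of_covers (K := (K : Set (EuclideanSpace ℝ (Fin 2))))
      (a := Real.goldenRatio ^ 6) (b := μ ^ 6) (C := 2 * C)
      (one_le_pow₀ Real.one_lt_goldenRatio.le) hμ6 (by positivity) fun m => by
        obtain ⟨ι, _, P, p, hcard, -, hc, hp⟩ := H m
        refine ⟨ι, inferInstance, p, hcard, ?_⟩
        rw [mul_assoc]
        exact subset_iUnion_closedBall_of_finite_approx hK (by positivity) hc hp
    refine hle.trans (le_of_eq ?_)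
    rw [Real.log_pow, Real.log_pow, mul_div_mul_left _ _ (by norm_num)]

end ScalingLimit

/-! ### The real recursion and its growth rate -/

/-- The dominant eigenvalue of the displacement recursion over three steps, for `c = cos α`. -/
noncomputable def growth (c : ℝ) : ℝ := 1 + c + √((1 + c) ^ 2 + 1)

theorem growth_sq (c : ℝ) : growth c ^ 2 = 1 + 2 * (1 + c) * growth c := by
  have h := Real.sq_sqrt (show 0 ≤ (1 + c) ^ 2 + 1 by positivity)
  unfold growth
  linear_combination h

theorem one_add_lt_growth (c : ℝ) : 1 + c < growth c := by
  have h : 0 < √((1 + c) ^ 2 + 1) := Real.sqrt_pos.2 (by positivity)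
  unfold growth
  linarith

theorem one_lt_growth {c : ℝ} (hc : 0 ≤ c) : 1 < growth c := by
  have := one_add_lt_growth c
  linarith

/-- The solutions of the real part of the displacement recursion grow like powers of `growth c`. -/
theorem exists_real_solution {c G₀ B₀ : ℝ} (hc : 0 ≤ c) (hG : 0 < G₀) (hB : 0 < B₀) :
    ∃ G B : ℕ → ℝ, G 0 = G₀ ∧ B 0 = B₀ ∧ (∀ k, G (k + 1) = G k + 2 * B k) ∧
      (∀ k, B (k + 1) = c * G (k + 1) + G k + B k) ∧
      ∃ g b : ℝ, 0 < b ∧ Tendsto (fun k => (growth c ^ k)⁻¹ * G k) atTop (𝓝 g) ∧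
        Tendsto (fun k => (growth c ^ k)⁻¹ * B k) atTop (𝓝 b) := by
  have hsq := growth_sq c
  have hlt := one_add_lt_growth c
  have h1 := one_lt_growth hc
  set x := growth c with hx
  have hr : 1 + c ≠ 0 := by positivity
  -- The second eigenvalue y = -1/x is dominated by x. The coefficients A and A' are solved from the
  -- initial values, and A > 0 becomes the limit b.
  obtain ⟨y, hy⟩ : ∃ y, y = 2 * (1 + c) - x := ⟨_, rfl⟩
  have hxy : x * y = -1 := by rw [hy]; linear_combination -hsq
  have hysq : y ^ 2 = 1 + 2 * (1 + c) * y := by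
    rw [hy] at hxy ⊢; linear_combination -hxy
  have hd : 0 < x - y := by rw [hy]; linarith
  obtain ⟨A, hA⟩ : ∃ A, A = ((1 + c) * G₀ + (x - 1) * B₀) / (x - y) := ⟨_, rfl⟩
  obtain ⟨A', hA'⟩ : ∃ A', A' = -((1 + c) * G₀ + (y - 1) * B₀) / (x - y) := ⟨_, rfl⟩
  have hApos : 0 < A := by
    rw [hA]
    have : 0 < x - 1 := by linarith
    positivity
  have hxyp : (x - 1) * (y - 1) = -2 * (1 + c) := by
    linear_combination hxy - hy
  have hlim : Tendsto (fun k => (x⁻¹ * y) ^ k) atTop (𝓝 0) := by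
    refine tendsto_pow_atTop_nhds_zero_of_abs_lt_one ?_
    have hx0 : 0 < x := by linarith
    have : x⁻¹ * y = -(x⁻¹ * x⁻¹) := by field_simp; linear_combination hxy
    have hlt1 : x⁻¹ < 1 := inv_lt_one_of_one_lt₀ h1
    have hpos : 0 < x⁻¹ := by positivity
    rw [this, abs_neg, abs_of_pos (by positivity)]
    nlinarith
  have hxk : ∀ k, (x ^ k)⁻¹ * x ^ k = 1 := fun k =>
    inv_mul_cancel₀ (pow_ne_zero _ (by linarith : x ≠ 0))
  refine ⟨fun k => -(A * (y - 1) * x ^ k + A' * (x - 1) * y ^ k) / (1 + c),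
    fun k => A * x ^ k + A' * y ^ k, ?_, ?_, ?_, ?_, -(A * (y - 1)) / (1 + c), A, hApos, ?_, ?_⟩
  · have : x - y ≠ 0 := hd.ne'
    simp only [hA, hA', pow_zero]
    field_simp
    ring
  · have : x - y ≠ 0 := hd.ne'
    simp only [hA, hA', pow_zero]
    field_simp
    ring
  · intro k
    field_simp
    rw [pow_succ, pow_succ]
    linear_combination (-A * x ^ k - A' * y ^ k) * hxyp
  · intro k
    field_simp
    rw [pow_succ, pow_succ]
    linear_combination (A * x ^ k + A' * y ^ k) * (c * hxy + hy)
  · have := (hlim.const_mul (A' * (x - 1))).const_add (A * (y - 1))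
    rw [mul_zero, add_zero] at this
    refine (this.neg.div_const (1 + c)).congr fun k => ?_
    rw [mul_pow, inv_pow]
    linear_combination (A * (y - 1)) / (1 + c) * hxk k
  · have := (hlim.const_mul A').const_add A
    rw [mul_zero, add_zero] at this
    refine this.congr fun k => ?_
    rw [mul_pow, inv_pow]
    linear_combination -A * hxk k

/-! ### Solving the displacement recursion -/

section Recursion

variable {z : ℕ → ℂ} {v : ℂ} {C T : ℝ}

/-- Three steps of the displacement recursion, in coordinates adapted to the headings. -/
theorem three_steps {a b a₁ a₂ a₃ v e γ β : ℂ} (hv : v * (starRingEnd ℂ) v = 1)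
    (he : e * (starRingEnd ℂ) e = 1) (ha : a = v * (starRingEnd ℂ) e * γ) (hb : b = v * e * β)
    (h₁ : a₁ = b + e ^ 2 * a) (h₂ : a₂ = a₁ + v ^ 2 * e ^ 2 * (starRingEnd ℂ) b)
    (h₃ : a₃ = a₂ + v ^ 2 * (starRingEnd ℂ) a₁) :
    a₂ = v * e * (γ + β + (starRingEnd ℂ) β) ∧
    a₃ = v * (starRingEnd ℂ) e *
      (e ^ 2 * (γ + β + (starRingEnd ℂ) β) + (starRingEnd ℂ) γ + (starRingEnd ℂ) β) := by
  have e₁ : a₁ = v * e * (β + γ) := by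
    rw [h₁, ha, hb]
    linear_combination v * e * γ * he
  have e₂ : a₂ = v * e * (γ + β + (starRingEnd ℂ) β) := by
    rw [h₂, e₁, hb]
    simp only [map_mul]
    linear_combination v * e * (starRingEnd ℂ) β * ((v * (starRingEnd ℂ) v) * he + hv)
  refine ⟨e₂, ?_⟩
  rw [h₃, e₂, e₁]
  simp only [map_mul, map_add]
  linear_combination v * (starRingEnd ℂ) e * ((starRingEnd ℂ) γ + (starRingEnd ℂ) β) * hv -
    v * e * (γ + β + (starRingEnd ℂ) β) * he

/-- The square root of the heading after the word with index `3 k + 1`. -/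
noncomputable def halfTurn (C T : ℝ) (k : ℕ) : ℂ := C + (-1) ^ k * T * Complex.I

theorem conj_halfTurn (C T : ℝ) (k : ℕ) :
    (starRingEnd ℂ) (halfTurn C T k) = halfTurn C T (k + 1) := by
  simp [halfTurn, pow_succ]

theorem halfTurn_mul_conj (hCT : C ^ 2 + T ^ 2 = 1) (k : ℕ) :
    halfTurn C T k * (starRingEnd ℂ) (halfTurn C T k) = 1 := by
  have h2 : ((-1 : ℂ) ^ k) ^ 2 = 1 := by rw [← pow_mul, mul_comm, pow_mul]; simp
  have h3 : (C : ℂ) ^ 2 + (T : ℂ) ^ 2 = 1 := by exact_mod_cast hCT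
  rw [conj_halfTurn, halfTurn, halfTurn, pow_succ]
  linear_combination h3 + (T : ℂ) ^ 2 * h2 - ((-1 : ℂ) ^ k) ^ 2 * (T : ℂ) ^ 2 * Complex.I_sq

/-- Closed form of the displacement recursion. -/
theorem displacement_closed_form {t g D : ℝ} {G B : ℕ → ℝ} (hv : v * (starRingEnd ℂ) v = 1)
    (hCT : C ^ 2 + T ^ 2 = 1) (ht : T = t * C)
    (h₁ : ∀ k, z (3 * k + 2) = z (3 * k + 1) + halfTurn C T k ^ 2 * z (3 * k))
    (h₂ : ∀ k, z (3 * k + 3) = z (3 * k + 2) +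
      v ^ 2 * halfTurn C T k ^ 2 * (starRingEnd ℂ) (z (3 * k + 1)))
    (h₃ : ∀ k, z (3 * k + 4) = z (3 * k + 3) + v ^ 2 * (starRingEnd ℂ) (z (3 * k + 2)))
    (hG : ∀ k, G (k + 1) = G k + 2 * B k)
    (hB : ∀ k, B (k + 1) = (C ^ 2 - T ^ 2) * G (k + 1) + G k + B k)
    (hz₀ : z 0 = v * halfTurn C T 1 * ((G 0 - t * g : ℝ) + g * Complex.I))
    (hz₁ : z 1 = v * halfTurn C T 0 * ((B 0 + t * g : ℝ) +
      (D - t * (B 0 + G 0) : ℝ) * Complex.I)) (k : ℕ) :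
    z (3 * k) = v * halfTurn C T (k + 1) * ((G k - (-1) ^ k * (t * g) : ℝ) + g * Complex.I) ∧
    z (3 * k + 1) = v * halfTurn C T k * ((B k + (-1) ^ k * (t * g) : ℝ) +
      ((-1) ^ k * (D - t * (B k + G k)) : ℝ) * Complex.I) := by
  induction k with
  | zero => exact ⟨by simpa using hz₀, by simpa using hz₁⟩
  | succ k ih =>
    -- Each round of three steps replaces e = `halfTurn C T k` by its conjugate, so the result has
    -- the same shape at k + 1.
    have h := three_steps hv (halfTurn_mul_conj hCT k) (by rw [conj_halfTurn]; exact ih.1) ih.2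
      (h₁ k) (h₂ k) (h₃ k)
    have hper : halfTurn C T (k + 1 + 1) = halfTurn C T k := by
      simp [halfTurn, pow_succ]
    rw [conj_halfTurn] at h
    -- Adding a number and its conjugate changes only the real part, so the imaginary part g is
    -- invariant. The corrections ± t g absorb its effect on the real recursion.
    have e₁ : ((G k - (-1) ^ k * (t * g) : ℝ) + g * Complex.I : ℂ) +
        ((B k + (-1) ^ k * (t * g) : ℝ) + ((-1) ^ k * (D - t * (B k + G k)) : ℝ) * Complex.I) +
        (starRingEnd ℂ) ((B k + (-1) ^ k * (t * g) : ℝ) +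
          ((-1) ^ k * (D - t * (B k + G k)) : ℝ) * Complex.I) =
        (G (k + 1) - (-1) ^ (k + 1) * (t * g) : ℝ) + g * Complex.I := by
      rw [hG, pow_succ]
      simp only [map_add, map_mul, Complex.conj_ofReal, Complex.conj_I]
      push_cast
      ring
    rw [e₁] at h
    refine ⟨by rw [hper]; exact h.1, h.2.trans ?_⟩
    congr 1
    have hη : ((-1 : ℝ) ^ k) ^ 2 = 1 := by rw [← pow_mul, mul_comm, pow_mul]; simp
    have hBk := hB k
    have hsq : halfTurn C T k ^ 2 = (C ^ 2 - T ^ 2 : ℝ) +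
        ((-1) ^ k * (2 * T * C) : ℝ) * Complex.I := by
      have hη' : ((-1 : ℂ) ^ k) ^ 2 = 1 := by rw [← pow_mul, mul_comm, pow_mul]; simp
      rw [halfTurn]
      push_cast
      linear_combination ((-1 : ℂ) ^ k) ^ 2 * (T : ℂ) ^ 2 * Complex.I_sq - (T : ℂ) ^ 2 * hη'
    have hs : (-1 : ℝ) ^ (k + 1) = (-1) ^ k * -1 := pow_succ _ _
    rw [hsq, hs]
    generalize (-1 : ℝ) ^ k = η at *
    apply Complex.ext
    -- With c = C² - T² and t = T / C, both components rest on 2TC = t(1 + c); the imaginary one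
    -- also uses 2TC t = 1 - c.
    · simp only [Complex.add_re, Complex.mul_re, Complex.add_im, Complex.mul_im, Complex.conj_re,
        Complex.ofReal_re, Complex.ofReal_im, Complex.I_re, Complex.I_im]
      linear_combination -hBk - η * g * (2 * C * ht + t * hCT)
    · simp only [Complex.add_re, Complex.mul_re, Complex.add_im, Complex.mul_im,
        Complex.conj_im, Complex.ofReal_re, Complex.ofReal_im, Complex.I_re, Complex.I_im]
      linear_combination -η * t * hBk + η * G (k + 1) * (2 * C * ht + t * hCT) +
        g * (2 * T * C * t * hη + hCT - 2 * T * ht)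

/-- The displacements are asymptotically geometric, and do not vanish in the limit. -/
theorem displacement_limits {c g G₀ B₀ D₀ t : ℝ} (hv : v * (starRingEnd ℂ) v = 1)
    (hCT : C ^ 2 + T ^ 2 = 1) (hc : C ^ 2 - T ^ 2 = c) (hc0 : 0 ≤ c) (ht : T = t * C)
    (h₁ : ∀ k, z (3 * k + 2) = z (3 * k + 1) + halfTurn C T k ^ 2 * z (3 * k))
    (h₂ : ∀ k, z (3 * k + 3) = z (3 * k + 2) +
      v ^ 2 * halfTurn C T k ^ 2 * (starRingEnd ℂ) (z (3 * k + 1)))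
    (h₃ : ∀ k, z (3 * k + 4) = z (3 * k + 3) + v ^ 2 * (starRingEnd ℂ) (z (3 * k + 2)))
    (hz₀ : z 0 = v * halfTurn C T 1 * ((G₀ - t * g : ℝ) + g * Complex.I))
    (hz₁ : z 1 = v * halfTurn C T 0 * ((B₀ + t * g : ℝ) + D₀ * Complex.I))
    (hG₀ : 0 < G₀) (hB₀ : 0 < B₀) :
    (∃ l, Tendsto (fun k => ((growth c ^ 2) ^ k)⁻¹ • z (6 * k)) atTop (𝓝 l)) ∧
    (∃ l ≠ 0, Tendsto (fun k => ((growth c ^ 2) ^ k)⁻¹ • z (6 * k + 1)) atTop (𝓝 l)) ∧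
    (∃ l ≠ 0, Tendsto (fun k => ((growth c ^ 2) ^ k)⁻¹ • z (6 * k + 4)) atTop (𝓝 l)) := by
  obtain ⟨G, B, rfl, rfl, hG, hB, a, b, hb, hGa, hBb⟩ := exists_real_solution hc0 hG₀ hB₀
  have hx := one_lt_growth hc0
  set x := growth c
  have hx0 : x ≠ 0 := by linarith
  -- This D makes the imaginary part at k = 0 equal to D₀.
  have hcf := displacement_closed_form (D := D₀ + t * (B 0 + G 0)) hv hCT ht h₁ h₂ h₃ hG
    (by rw [hc]; exact hB) hz₀ (by simpa using hz₁)
  have hconst : ∀ s : ℝ, Tendsto (fun k : ℕ => (x ^ k)⁻¹ * s) atTop (𝓝 0) := by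
    intro s
    have := (tendsto_pow_atTop_nhds_zero_of_lt_one (r := x⁻¹) (by positivity)
      (inv_lt_one_of_one_lt₀ hx)).mul_const s
    simpa using this
  have heven : Tendsto (fun k : ℕ => 2 * k) atTop atTop :=
    StrictMono.tendsto_atTop fun a b h => by omega
  have hodd : Tendsto (fun k : ℕ => 2 * k + 1) atTop atTop :=
    StrictMono.tendsto_atTop fun a b h => by omega
  have hne : ∀ k, halfTurn C T k ≠ 0 := fun k h => by
    simpa [h] using halfTurn_mul_conj hCT k
  have hv0 : v ≠ 0 := fun h => by simp [h] at hv
  have hper : ∀ k, halfTurn C T (2 * k) = halfTurn C T 0 ∧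
      halfTurn C T (2 * k + 1) = halfTurn C T 1 := by
    intro k
    simp [halfTurn, pow_succ, pow_mul]
  have hpow : ∀ k : ℕ, (-1 : ℝ) ^ (2 * k) = 1 := fun k => by simp [pow_mul]
  have hofReal : ∀ {u w : ℕ → ℝ} {p q : ℝ}, Tendsto u atTop (𝓝 p) → Tendsto w atTop (𝓝 q) →
      Tendsto (fun k => (u k : ℂ) + w k * Complex.I) atTop (𝓝 (p + q * Complex.I)) :=
    fun hu hw => ((Complex.continuous_ofReal.tendsto _).comp hu).add
      (((Complex.continuous_ofReal.tendsto _).comp hw).mul_const _)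
  -- The limits at residues 1 and 4 are nonzero because b > 0, whatever the imaginary part.
  have hre : ∀ q : ℝ, (b : ℂ) + q * Complex.I ≠ 0 := fun q h => by
    have := congrArg Complex.re h
    simp at this
    exact hb.ne' this
  have hA : Tendsto (fun k => (x ^ k)⁻¹ * (D₀ + t * (B 0 + G 0) - t * (B k + G k))) atTop
      (𝓝 (0 - t * (b + a))) := by
    refine ((hconst (D₀ + t * (B 0 + G 0))).sub ((hBb.add hGa).const_mul t)).congr fun k => ?_
    ring
  refine ⟨⟨v * halfTurn C T 1 * ((a - 0 : ℝ) + (0 : ℝ) * Complex.I), ?_⟩,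
    ⟨v * halfTurn C T 0 * ((b + 0 : ℝ) + (0 - t * (b + a) : ℝ) * Complex.I), ?_, ?_⟩,
    ⟨v * halfTurn C T 1 * ((x : ℂ) * ((b - 0 : ℝ) + (-(0 - t * (b + a)) : ℝ) * Complex.I)), ?_, ?_⟩⟩
  · refine ((hofReal ((hGa.comp heven).sub ((hconst (t * g)).comp heven))
      ((hconst g).comp heven)).const_mul (v * halfTurn C T 1)).congr fun k => ?_
    have h := (hcf (2 * k)).1
    rw [show 3 * (2 * k) = 6 * k by ring, (hper k).2, hpow] at h
    rw [h, ← pow_mul, Complex.real_smul]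
    simp only [Function.comp_apply]
    push_cast
    ring
  · rw [add_zero]
    exact mul_ne_zero (mul_ne_zero hv0 (hne 0)) (hre _)
  · refine ((hofReal ((hBb.comp heven).add ((hconst (t * g)).comp heven))
      (hA.comp heven)).const_mul (v * halfTurn C T 0)).congr fun k => ?_
    have h := (hcf (2 * k)).2
    rw [show 3 * (2 * k) = 6 * k by ring, (hper k).1, hpow] at h
    rw [h, ← pow_mul, Complex.real_smul]
    simp only [Function.comp_apply]
    push_cast
    ring
  · rw [sub_zero]
    exact mul_ne_zero (mul_ne_zero hv0 (hne 1))
      (mul_ne_zero (Complex.ofReal_ne_zero.2 hx0) (hre _))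
  · refine (((hofReal ((hBb.comp hodd).sub ((hconst (t * g)).comp hodd))
      (hA.comp hodd).neg).const_mul (x : ℂ)).const_mul (v * halfTurn C T 1)).congr fun k => ?_
    have h := (hcf (2 * k + 1)).2
    rw [show 3 * (2 * k + 1) + 1 = 6 * k + 4 by ring, (hper k).2, pow_succ, hpow] at h
    have hx' : (x : ℂ) ≠ 0 := Complex.ofReal_ne_zero.2 hx0
    rw [h, ← pow_mul, Complex.real_smul]
    simp only [Function.comp_apply, pow_succ]
    push_cast
    field_simp
    ring

end Recursion

/-! ### Word families with parity pattern odd, even, odd -/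

section WordFamily

variable {h : ℕ → List (Fin 2)}

/-- The lengths modulo 2 follow the Fibonacci recursion, of period 3. An odd word negates the turns
of its successor, so over one period the turn of the even word changes sign. -/
theorem family_turns (hh : ∀ n, h (n + 2) = h (n + 1) ++ h n) (hodd : Odd (h 0).length)
    (heven : Even (h 1).length) (k : ℕ) :
    (Odd (h (3 * k)).length ∧ Even (h (3 * k + 1)).length ∧ Odd (h (3 * k + 2)).length) ∧
    turnSum (h (3 * k)) = turnSum (h 0) ∧
    turnSum (h (3 * k + 1)) = (-1) ^ k * turnSum (h 1) ∧
    turnSum (h (3 * k + 2)) = turnSum (h 0) + (-1) ^ k * turnSum (h 1) := by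
  have key : ∀ k, Odd (h (3 * k)).length → Even (h (3 * k + 1)).length →
      Odd (h (3 * k + 2)).length ∧
      turnSum (h (3 * k + 2)) = turnSum (h (3 * k)) + turnSum (h (3 * k + 1)) := by
    intro k h₀ h₁
    rw [hh, turnSum_append, List.length_append, h₁.neg_one_pow]
    exact ⟨h₁.add_odd h₀, by ring⟩
  induction k with
  | zero => simpa [hodd, heven] using key 0 hodd heven
  | succ k ih =>
    obtain ⟨⟨h₀, h₁, h₂⟩, t₀, t₁, t₂⟩ := ih
    have h₃ : Odd (h (3 * (k + 1))).length := by
      rw [show 3 * (k + 1) = 3 * k + 1 + 2 by ring, hh, List.length_append]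
      exact h₂.add_even h₁
    have t₃ : turnSum (h (3 * (k + 1))) = turnSum (h 0) := by
      rw [show 3 * (k + 1) = 3 * k + 1 + 2 by ring, hh, turnSum_append, h₂.neg_one_pow, t₁, t₂]
      ring
    have h₄ : Even (h (3 * (k + 1) + 1)).length := by
      rw [show 3 * (k + 1) + 1 = 3 * k + 2 + 2 by ring, hh, List.length_append]
      exact h₃.add_odd h₂
    have t₄ : turnSum (h (3 * (k + 1) + 1)) = (-1) ^ (k + 1) * turnSum (h 1) := by
      rw [show 3 * (k + 1) + 1 = 3 * k + 2 + 2 by ring, hh, turnSum_append,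
        show 3 * k + 2 + 1 = 3 * (k + 1) by ring, h₃.neg_one_pow, t₂, t₃, pow_succ]
      ring
    have h₅ := key (k + 1) h₃ h₄
    exact ⟨⟨h₃, h₄, h₅.1⟩, t₃, t₄, by rw [h₅.2, t₃, t₄]⟩

/-- Three steps restore the parities and six also restore the alternating sign. -/
theorem wordIsom_periodic (hh : ∀ n, h (n + 2) = h (n + 1) ++ h n) (hodd : Odd (h 0).length)
    (heven : Even (h 1).length) (α : ℝ) (n : ℕ) : wordIsom α (h (n + 6)) = wordIsom α (h n) := by
  have key : (Even (h (n + 6)).length ↔ Even (h n).length) ∧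
      turnSum (h (n + 6)) = turnSum (h n) := by
    obtain ⟨⟨a₀, a₁, a₂⟩, a₃, a₄, a₅⟩ := family_turns hh hodd heven (n / 3)
    obtain ⟨⟨b₀, b₁, b₂⟩, b₃, b₄, b₅⟩ := family_turns hh hodd heven (n / 3 + 2)
    rw [← Nat.not_even_iff_odd] at a₀ a₂ b₀ b₂
    have hn := Nat.div_add_mod n 3
    have hlt := Nat.mod_lt n (by norm_num : 0 < 3)
    generalize n / 3 = k at *
    generalize n % 3 = r at *
    subst hn
    interval_cases r
    · rw [show 3 * k + 0 + 6 = 3 * (k + 2) by ring, show 3 * k + 0 = 3 * k from rfl, b₃, a₃]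
      exact ⟨by tauto, rfl⟩
    · rw [show 3 * k + 1 + 6 = 3 * (k + 2) + 1 by ring, b₄, a₄, pow_add]
      exact ⟨by tauto, by ring⟩
    · rw [show 3 * k + 2 + 6 = 3 * (k + 2) + 2 by ring, b₅, a₅, pow_add]
      exact ⟨by tauto, by ring⟩
  unfold wordIsom
  rw [key.2]
  simp only [key.1]

theorem halfTurn_cos_sin (x : ℝ) (k : ℕ) : halfTurn (Real.cos x) (Real.sin x) k =
    Complex.exp (((-1) ^ k * x : ℝ) * Complex.I) := by
  rw [Complex.exp_mul_I, ← Complex.ofReal_cos, ← Complex.ofReal_sin, halfTurn]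
  rcases neg_one_pow_eq_or ℝ k with hk | hk
  · have hk' : (-1 : ℂ) ^ k = 1 := by exact_mod_cast congrArg Complex.ofReal hk
    simp [hk, hk']
  · have hk' : (-1 : ℂ) ^ k = -1 := by exact_mod_cast congrArg Complex.ofReal hk
    simp [hk, hk']

/-- Existence and dimension bounds of the scaling limit for a family of words obeying the
Fibonacci recursion, in terms of the displacements of the first two words. -/
theorem exists_family_limit (hh : ∀ n, h (n + 2) = h (n + 1) ++ h n) (hodd : Odd (h 0).length)
    (heven : Even (h 1).length) {α C T t g G₀ B₀ D₀ : ℝ} {v : ℂ}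
    (hC : Real.cos (α * turnSum (h 1) / 2) = C) (hT : Real.sin (α * turnSum (h 1) / 2) = T)
    (hv : Complex.exp ((α * turnSum (h 0) / 2 : ℝ) * Complex.I) = v)
    (hc0 : 0 ≤ C ^ 2 - T ^ 2) (ht : T = t * C)
    (hz₀ : wordEnd α (h 0) = v * halfTurn C T 1 * ((G₀ - t * g : ℝ) + g * Complex.I))
    (hz₁ : wordEnd α (h 1) = v * halfTurn C T 0 * ((B₀ + t * g : ℝ) + D₀ * Complex.I))
    (hG₀ : 0 < G₀) (hB₀ : 0 < B₀) {ρ : ℕ} (hρ : ρ = 1 ∨ ρ = 4)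
    {S : ℕ → TopologicalSpace.NonemptyCompacts (EuclideanSpace ℝ (Fin 2))}
    (hS : ∀ k, (S k : Set (EuclideanSpace ℝ (Fin 2))) =
      (fun x => (√2 / ‖wordEnd α (h (6 * k + ρ))‖) • x) '' wordCurve α (h (6 * k + ρ))) :
    ∃ K, Tendsto S atTop (𝓝 K) ∧ 1 ≤ dimH (K : Set (EuclideanSpace ℝ (Fin 2))) ∧
      dimH (K : Set (EuclideanSpace ℝ (Fin 2))) ≤ ENNReal.ofReal
        (3 * Real.log Real.goldenRatio / Real.log (growth (C ^ 2 - T ^ 2))) := by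
  have hturns := family_turns hh hodd heven
  have hhalf : ∀ k, halfTurn C T k ^ 2 =
      Complex.exp ((α * ((-1) ^ k * turnSum (h 1)) : ℝ) * Complex.I) := by
    intro k
    rw [← hC, ← hT, halfTurn_cos_sin, ← Complex.exp_nat_mul]
    congr 1
    push_cast
    ring
  have hv2 : v ^ 2 = Complex.exp ((α * turnSum (h 0) : ℝ) * Complex.I) := by
    rw [← hv, ← Complex.exp_nat_mul]
    congr 1
    push_cast
    ring
  have hv1 : v * (starRingEnd ℂ) v = 1 := by
    rw [Complex.mul_conj, Complex.normSq_eq_norm_sq, ← hv, Complex.norm_exp_ofReal_mul_I]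
    simp
  have hCT : C ^ 2 + T ^ 2 = 1 := by rw [← hC, ← hT, Real.cos_sq_add_sin_sq]
  obtain ⟨l₀, ⟨l₁, hl₁, h₁⟩, ⟨l₄, hl₄, h₄⟩⟩ :=
    displacement_limits (z := fun n => wordEnd α (h n)) hv1 hCT rfl hc0 ht
      (fun k => by
        obtain ⟨⟨a₀, a₁, a₂⟩, b₀, b₁, b₂⟩ := hturns k
        rw [hh, wordEnd_append, wordIsom_of_even a₁, b₁, hhalf])
      (fun k => by
        obtain ⟨⟨a₀, a₁, a₂⟩, b₀, b₁, b₂⟩ := hturns k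
        rw [show 3 * k + 3 = 3 * k + 1 + 2 by ring, hh, wordEnd_append, wordIsom_of_odd a₂, b₂,
          hhalf, hv2, ← Complex.exp_add]
        congr 3
        push_cast
        ring)
      (fun k => by
        obtain ⟨⟨a₀, a₁, a₂⟩, b₀, b₁, b₂⟩ := hturns (k + 1)
        rw [show 3 * k + 4 = 3 * k + 2 + 2 by ring, hh, wordEnd_append,
          show 3 * k + 2 + 1 = 3 * (k + 1) by ring, wordIsom_of_odd a₀, b₀, hv2,
          show 3 * (k + 1) = 3 * k + 3 by ring])
      hz₀ hz₁ hG₀ hB₀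
  have hx := one_lt_growth hc0
  set x := growth (C ^ 2 - T ^ 2)
  have hx0 : 0 < x := by linarith
  -- x measures growth over three steps, so the rate per step is its cube root.
  set μ : ℝ := x ^ (1 / 3 : ℝ) with hμ
  have hμ1 : 1 < μ := Real.one_lt_rpow hx (by norm_num)
  have hμ6 : μ ^ 6 = x ^ 2 := by
    rw [hμ, ← Real.rpow_natCast, ← Real.rpow_mul hx0.le, ← Real.rpow_natCast]
    norm_num
  have hlog : Real.log Real.goldenRatio / Real.log μ =
      3 * Real.log Real.goldenRatio / Real.log x := by
    rw [hμ, Real.log_rpow hx0]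
    field_simp
  rw [← hμ6] at l₀ h₁ h₄
  rw [← hlog]
  have hL := wordIsom_periodic hh hodd heven α
  rcases hρ with rfl | rfl
  · exact exists_scaling_limit hμ1 hh hL l₀ ⟨_, h₁⟩ h₁ hl₁ hS
  · exact exists_scaling_limit hμ1 hh hL l₀ ⟨_, h₁⟩ h₄ hl₄ hS

end WordFamily

/-! ### Initial words and the two parities of i -/

theorem turnSum_zero_letter : turnSum [0] = -1 := by simp [turnSum, turn]

theorem turnSum_one_letter : turnSum [1] = 0 := by simp [turnSum, turn]

theorem wordEnd_singleton (α : ℝ) (b : Fin 2) : wordEnd α [b] = 1 := by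
  simp [wordEnd, relVertex, turnSum]

theorem turnSum_replicate_even (m : ℕ) : turnSum (List.replicate (2 * m) 0) = 0 := by
  induction m with
  | zero => simp [turnSum]
  | succ m ih =>
    rw [show 2 * (m + 1) = 2 * m + 1 + 1 by ring, List.replicate_succ', List.replicate_succ',
      turnSum_append, turnSum_append, ih, turnSum_zero_letter]
    simp [pow_succ, pow_mul]

theorem wordEnd_replicate_even (α : ℝ) (m : ℕ) : wordEnd α (List.replicate (2 * m) 0) =
    m * (1 + Complex.exp ((-α : ℝ) * Complex.I)) := by
  induction m with
  | zero => simp [wordEnd, relVertex]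
  | succ m ih =>
    rw [show 2 * (m + 1) = 2 * m + 1 + 1 by ring, List.replicate_succ', List.replicate_succ',
      wordEnd_append, wordEnd_append, ih, wordIsom_of_even (by simp), wordIsom_of_odd (by simp),
      turnSum_append, turnSum_replicate_even, turnSum_zero_letter, wordEnd_singleton]
    simp [pow_mul]
    ring

theorem half_angle_bounds {α : ℝ} (hα : α ∈ Set.Ioc (0 : ℝ) (Real.pi / 2)) :
    0 < Real.cos (α / 2) ∧ Real.cos (α / 2) ^ 2 - Real.sin (α / 2) ^ 2 = Real.cos α ∧
      0 ≤ Real.cos α := by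
  have hπ := Real.pi_pos
  refine ⟨Real.cos_pos_of_mem_Ioo ⟨by linarith [hα.1], by linarith [hα.2]⟩, ?_,
    Real.cos_nonneg_of_mem_Icc ⟨by linarith [hα.1], hα.2⟩⟩
  rw [← Real.cos_two_mul']
  congr 1
  ring

theorem exp_half_mul_I (α : ℝ) : Complex.exp ((α / 2 : ℝ) * Complex.I) =
    Real.cos (α / 2) + Real.sin (α / 2) * Complex.I := by
  rw [Complex.exp_mul_I, ← Complex.ofReal_cos, ← Complex.ofReal_sin]

theorem exp_neg_mul_I (α : ℝ) : Complex.exp ((-α : ℝ) * Complex.I) =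
    (Real.cos (α / 2) - Real.sin (α / 2) * Complex.I) ^ 2 := by
  have h : (Real.cos (α / 2) - Real.sin (α / 2) * Complex.I : ℂ) =
      Complex.exp ((-(α / 2) : ℝ) * Complex.I) := by
    rw [Complex.exp_mul_I, ← Complex.ofReal_cos, ← Complex.ofReal_sin, Real.cos_neg, Real.sin_neg]
    push_cast
    ring
  rw [h, ← Complex.exp_nat_mul]
  congr 1
  push_cast
  ring

theorem coe_scaledFibCurve (i : ℕ) (α : ℝ) (n : ℕ) :
    (scaledFibCurve i α n : Set (EuclideanSpace ℝ (Fin 2))) =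
      (fun x => (√2 / ‖wordEnd α (fibWord i n)‖) • x) '' wordCurve α (fibWord i n) := by
  rw [scaledFibCurve, TopologicalSpace.NonemptyCompacts.coe_map, fibWidth, norm_wordEnd]
  rfl

/-- The first two words have lengths 1 and i, odd and even, so the family starts at index 1 and 6k +
5 is its residue 4. -/
theorem exists_limit_of_even {i : ℕ} (hi : 2 ≤ i) (hev : Even i) {α : ℝ}
    (hα : α ∈ Set.Ioc (0 : ℝ) (Real.pi / 2)) :
    ∃ K, Tendsto (fun k : ℕ => scaledFibCurve i α (fibIndex i k)) atTop (𝓝 K) ∧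
      1 ≤ dimH (K : Set (EuclideanSpace ℝ (Fin 2))) ∧
      dimH (K : Set (EuclideanSpace ℝ (Fin 2))) ≤ ENNReal.ofReal
        (3 * Real.log Real.goldenRatio / Real.log (growth (Real.cos α))) := by
  obtain ⟨hC, hcos, hc0⟩ := half_angle_bounds hα
  obtain ⟨m, hm⟩ : ∃ m, i = 2 * m + 2 := by
    obtain ⟨n, rfl⟩ := hev
    exact ⟨n - 1, by omega⟩
  have hw : fibWord i 2 = List.replicate (2 * m) 0 ++ [0] ++ [1] := by
    rw [fibWord, hm, show 2 * m + 2 - 1 = 2 * m + 1 by omega, List.replicate_succ']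
  have ht₀ : turnSum (fibWord i (0 + 1)) = -1 := turnSum_zero_letter
  have ht₁ : turnSum (fibWord i (1 + 1)) = -1 := by
    rw [hw, turnSum_append, turnSum_append, turnSum_replicate_even, turnSum_zero_letter,
      turnSum_one_letter]
    simp [pow_mul]
  have hz₀ : wordEnd α (fibWord i (0 + 1)) = 1 := wordEnd_singleton α 0
  have hz₁ : wordEnd α (fibWord i (1 + 1)) =
      (m + 1) * (1 + Complex.exp ((-α : ℝ) * Complex.I)) := by
    rw [hw, wordEnd_append, wordEnd_append, wordEnd_replicate_even, wordIsom_of_even (by simp),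
      wordIsom_of_odd (by simp), turnSum_append, turnSum_replicate_even, turnSum_zero_letter,
      wordEnd_singleton, wordEnd_singleton]
    simp [pow_mul]
    ring
  rw [exp_neg_mul_I] at hz₁
  have hS : ∀ k, (scaledFibCurve i α (fibIndex i k) : Set (EuclideanSpace ℝ (Fin 2))) =
      (fun x => (√2 / ‖wordEnd α (fibWord i (6 * k + 4 + 1))‖) • x) ''
        wordCurve α (fibWord i (6 * k + 4 + 1)) := by
    intro k
    rw [coe_scaledFibCurve, fibIndex, if_pos hev]
  have hCT : (Real.cos (α / 2) : ℂ) ^ 2 + (Real.sin (α / 2) : ℂ) ^ 2 = 1 := by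
    exact_mod_cast Real.cos_sq_add_sin_sq (α / 2)
  have hv : Complex.exp ((α * turnSum (fibWord i (0 + 1)) / 2 : ℝ) * Complex.I) =
      Real.cos (α / 2) - Real.sin (α / 2) * Complex.I := by
    rw [ht₀, show α * -1 / 2 = -α / 2 by ring, exp_half_mul_I, neg_div, Real.cos_neg, Real.sin_neg]
    push_cast
    ring
  set C := Real.cos (α / 2)
  set T := Real.sin (α / 2)
  -- Both initial words turn by -α, hence `-T`. Removing the prescribed unit factors from 1 and 2(m
  -- + 1)C(C - Ti) leaves 1 and 2(m + 1)C(C + Ti), which give the parameters.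
  have hres := exists_family_limit (h := fun n => fibWord i (n + 1)) (fun n => rfl)
    (by simp [fibWord]) (by simp [hw, parity_simps]) (α := α)
    (C := C) (T := -T) (t := -(T / C))
    (g := 0) (G₀ := 1) (B₀ := 2 * (m + 1) * C ^ 2)
    (D₀ := 2 * (m + 1) * C * T)
    (by rw [ht₁, ← Real.cos_neg]; congr 1; ring)
    (by rw [ht₁, ← Real.sin_neg]; congr 1; ring) hv
    (by rw [neg_sq, hcos]; exact hc0) (by field_simp)
    (by
      rw [hz₀, halfTurn]
      push_cast
      linear_combination -hCT + (T : ℂ) ^ 2 * Complex.I_sq)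
    (by
      rw [hz₁, halfTurn]
      push_cast
      linear_combination (m + 1) * (1 + 2 * C * (C - T * Complex.I)) *
        (-hCT + (T : ℂ) ^ 2 * Complex.I_sq))
    one_pos (by positivity) (Or.inr rfl) hS
  rwa [neg_sq, hcos] at hres

/-- Here the second and third words have lengths i and i + 1, odd and even, so the family starts at
index 2 and 6k + 3 is its residue 1. -/
theorem exists_limit_of_odd {i : ℕ} (hod : Odd i) {α : ℝ}
    (hα : α ∈ Set.Ioc (0 : ℝ) (Real.pi / 2)) :
    ∃ K, Tendsto (fun k : ℕ => scaledFibCurve i α (fibIndex i k)) atTop (𝓝 K) ∧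
      1 ≤ dimH (K : Set (EuclideanSpace ℝ (Fin 2))) ∧
      dimH (K : Set (EuclideanSpace ℝ (Fin 2))) ≤ ENNReal.ofReal
        (3 * Real.log Real.goldenRatio / Real.log (growth (Real.cos α))) := by
  obtain ⟨hC, hcos, hc0⟩ := half_angle_bounds hα
  obtain ⟨m, hm⟩ := hod
  have hw : fibWord i 2 = List.replicate (2 * m) 0 ++ [1] := by
    rw [fibWord, hm, Nat.add_sub_cancel]
  have hw' : fibWord i 3 = fibWord i 2 ++ [0] := rfl
  have hlen : Odd (fibWord i 2).length := by simp [hw]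
  have ht₀ : turnSum (fibWord i (0 + 2)) = 0 := by
    rw [hw, turnSum_append, turnSum_replicate_even, turnSum_one_letter]
    simp
  have ht₁ : turnSum (fibWord i (1 + 2)) = 1 := by
    rw [hw', turnSum_append, hlen.neg_one_pow, ht₀, turnSum_zero_letter]
    simp
  have hz₀ : wordEnd α (fibWord i (0 + 2)) =
      m * (1 + Complex.exp ((-α : ℝ) * Complex.I)) + 1 := by
    rw [hw, wordEnd_append, wordEnd_replicate_even, wordIsom_of_even (by simp),
      turnSum_replicate_even, wordEnd_singleton]
    simp
  have hz₁ : wordEnd α (fibWord i (1 + 2)) =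
      m * (1 + Complex.exp ((-α : ℝ) * Complex.I)) + 2 := by
    rw [hw', wordEnd_append, hz₀, wordIsom_of_odd hlen, ht₀, wordEnd_singleton]
    simp
    ring
  rw [exp_neg_mul_I] at hz₀ hz₁
  have hS : ∀ k, (scaledFibCurve i α (fibIndex i k) : Set (EuclideanSpace ℝ (Fin 2))) =
      (fun x => (√2 / ‖wordEnd α (fibWord i (6 * k + 1 + 2))‖) • x) ''
        wordCurve α (fibWord i (6 * k + 1 + 2)) := by
    intro k
    rw [coe_scaledFibCurve, fibIndex, if_neg (by rw [hm]; simp)]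
  have hCT' := Real.cos_sq_add_sin_sq (α / 2)
  have hCT : (Real.cos (α / 2) : ℂ) ^ 2 + (Real.sin (α / 2) : ℂ) ^ 2 = 1 := by
    exact_mod_cast hCT'
  set C := Real.cos (α / 2)
  set T := Real.sin (α / 2)
  -- T² ≤ C² because cos α ≥ 0. This keeps B₀ positive despite the correction t g = T² / C.
  have htT : T / C * T ≤ C := by
    rw [div_mul_eq_mul_div, div_le_iff₀ hC]
    nlinarith
  have hm0 : (0 : ℝ) ≤ m := Nat.cast_nonneg m
  -- The first displacement is (C - Ti)((2m + 1)C + Ti), so g = T, and G₀ compensates for the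
  -- correction t g.
  have hres := exists_family_limit (h := fun n => fibWord i (n + 2)) (fun n => rfl)
    (v := 1) hlen (by simp [hw', hw, parity_simps]) (α := α)
    (C := C) (T := T) (t := T / C) (g := T) (G₀ := (2 * m + 1) * C + T / C * T)
    (B₀ := 2 * m * C * (C ^ 2 - T ^ 2) + 2 * C - T / C * T)
    (D₀ := -(4 * m * C ^ 2 * T + 2 * T))
    (by rw [ht₁, mul_one]) (by rw [ht₁, mul_one]) (by rw [ht₀]; simp)
    (by rw [hcos]; exact hc0) (by field_simp)
    (by
      rw [hz₀, halfTurn]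
      push_cast
      linear_combination (m + 1) * (-hCT + (T : ℂ) ^ 2 * Complex.I_sq))
    (by
      rw [hz₁, halfTurn]
      push_cast
      linear_combination (m + 2 * m * C * (C - T * Complex.I) + 2) *
        (-hCT + (T : ℂ) ^ 2 * Complex.I_sq) +
        2 * m * C * (C + T * Complex.I) * (T : ℂ) ^ 2 * Complex.I_sq)
    (add_pos_of_pos_of_nonneg (by positivity)
      (by rw [div_mul_eq_mul_div]; exact div_nonneg (mul_self_nonneg T) hC.le))
    (by have : 0 ≤ 2 * m * C * (C ^ 2 - T ^ 2) := by rw [hcos]; positivity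
        linarith) (Or.inl rfl) hS
  rwa [hcos] at hres

/-! ### The limit as the angle tends to 0 -/

theorem growth_one : growth 1 = Real.goldenRatio ^ 3 := by
  have h5 : √((1 + 1 : ℝ) ^ 2 + 1) = √5 := by norm_num
  rw [growth, h5, Real.goldenRatio]
  have h := Real.sq_sqrt (show (0 : ℝ) ≤ 5 by norm_num)
  linear_combination (-(3 / 8) - √5 / 8) * h

theorem tendsto_dimension_bound : Tendsto (fun α : ℝ => ENNReal.ofReal
    (3 * Real.log Real.goldenRatio / Real.log (growth (Real.cos α)))) (𝓝[>] 0) (𝓝 1) := by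
  have hφ : 0 < Real.log Real.goldenRatio := Real.log_pos Real.one_lt_goldenRatio
  have hcont : ContinuousAt (fun α : ℝ => growth (Real.cos α)) 0 := by
    unfold growth
    fun_prop
  have h1 : growth (Real.cos 0) = Real.goldenRatio ^ 3 := by rw [Real.cos_zero, growth_one]
  have hlog : Real.log (growth (Real.cos 0)) = 3 * Real.log Real.goldenRatio := by
    rw [h1, Real.log_pow]
    norm_num
  have hlim : Tendsto (fun α : ℝ => 3 * Real.log Real.goldenRatio /
      Real.log (growth (Real.cos α))) (𝓝 0) (𝓝 1) := by
    have h2 : ContinuousAt (fun α : ℝ => 3 * Real.log Real.goldenRatio /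
        Real.log (growth (Real.cos α))) 0 :=
      continuousAt_const.div (hcont.log (by rw [h1]; have := Real.goldenRatio_pos; positivity))
        (by rw [hlog]; positivity)
    have h3 := h2.tendsto
    rwa [hlog, div_self (by positivity)] at h3
  rw [← ENNReal.ofReal_one]
  exact ENNReal.tendsto_ofReal (hlim.mono_left nhdsWithin_le_nhds)

theorem fibFractal_spec {i : ℕ} (hi : 2 ≤ i) {α : ℝ} (hα : α ∈ Set.Ioc (0 : ℝ) (Real.pi / 2)) :
    Tendsto (fun k : ℕ => scaledFibCurve i α (fibIndex i k)) atTop (𝓝 (fibFractal i α)) ∧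
      1 ≤ dimH (fibFractal i α : Set (EuclideanSpace ℝ (Fin 2))) ∧
      dimH (fibFractal i α : Set (EuclideanSpace ℝ (Fin 2))) ≤ ENNReal.ofReal
        (3 * Real.log Real.goldenRatio / Real.log (growth (Real.cos α))) := by
  obtain ⟨K, hK, h⟩ := (Nat.even_or_odd i).elim (fun hev => exists_limit_of_even hi hev hα)
    fun hod => exists_limit_of_odd hod hα
  have : fibFractal i α = K := hK.limUnder_eq
  rw [this]
  exact ⟨hK, h⟩

/-- The first conjunct says that the scaling limit defining the fractal does exist for every drawing
angle in `(0, π/2]`; the second is the limit of the Hausdorff dimension. -/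
theorem corollary5p9 (i : ℕ) (hi : 2 ≤ i) :
    (∀ α ∈ Set.Ioc (0 : ℝ) (Real.pi / 2),
      Tendsto (fun k : ℕ => scaledFibCurve i α (fibIndex i k)) atTop (𝓝 (fibFractal i α))) ∧
    Tendsto (fun α : ℝ => dimH (fibFractal i α : Set (EuclideanSpace ℝ (Fin 2))))
      (𝓝[>] 0) (𝓝 1) := by
  refine ⟨fun α hα => (fibFractal_spec hi hα).1, ?_⟩
  have hmem : ∀ᶠ α : ℝ in 𝓝[>] 0, α ∈ Set.Ioc (0 : ℝ) (Real.pi / 2) :=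
    Ioc_mem_nhdsGT (by positivity)
  exact tendsto_of_tendsto_of_tendsto_of_le_of_le' tendsto_const_nhds tendsto_dimension_bound
    (hmem.mono fun α hα => (fibFractal_spec hi hα).2.1)
    (hmem.mono fun α hα => (fibFractal_spec hi hα).2.2)
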